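/- Let $n\ge 1$ and $1<p<\infty$, with $\frac1p+\frac1{p'}=1$. A weight is a function $w\in L^1_{loc}(\mathbb R^n)$ with $w>0$ almost everywhere; $w\in A_p$ means that $$[w]_{A_p}=\sup_Q\Big(\frac1{|Q|}\int_Q w\Big)\Big(\frac1{|Q|}\int_Q w^{1-p'}\Big)^{p-1}<\infty ,$$ the supremum being over all cubes $Q\subset\mathbb R^n$. For $u,v\in A_p$ put $d_*(u,v)=\|\log u-\log v\|_*$, where $\|f\|_*=\sup_Q\frac1{|Q|}\int_Q|f-f_Q|\,dx$ and $f_Q=\frac1{|Q|}\int_Q f$. Functions are real- or complex-valued, and functions that agree a.e. are identified. An operator $T$ is defined on a linear space of measurable functions and takes measurable functions as values; it is sublinear if $|T(f+g)|\le|Tf|+|Tg|$ and $|T(kf)|=|k||Tf|$ a.e. for all $f,g$ in its domain and all scalars $k$. Let $c>0$ and let $F:[1,\infty)\to\mathbb R$ be increasing. Say that $T$ satisfies (H) if for every $w\in A_p$ it is defined on all of $L^p(w)$ and $$\|T\|_{L^p(w)\to L^p(w)}\le c\,F([w]_{A_p}).$$ (1) If $T$ is linear and satisfies (H), then for every $w_0\in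 A_p$ $$\lim_{w\in A_p,\ d_*(w,w_0)\to0}\|T\|_{L^p(w)\to L^p(w)}=\|T\|_{L^p(w_0)\to L^p(w_0)} .$$ (2) If $T$ is sublinear and satisfies (H), and $w_0\in A_p$, then $$\|T\|_{L^p(w)\to L^p(w)}\le\|T\|_{L^p(w_0)\to L^p(w_0)}\,(1+C\delta)$$ for all $0<\delta\le\delta_0$ and all $w\in A_p$ with $d_*(w,w_0)\le\delta$. Here $\delta_0>0$ depends only on $n$, $p$, $c$, $F$ and $[w_0]_{A_p}$, and $C>0$ depends only on these and on the number $\|T\|_{L^p(w_0)\to L^p(w_0)}$. -/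

import Mathlib

open MeasureTheory Filter Topology
open scoped ENNReal

noncomputable section

namespace WeightedContinuity

/-- The closed cube in `ℝⁿ` with sides parallel to the axes, lower corner `a` and side length `l`. -/
def cube {n : ℕ} (a : Fin n → ℝ) (l : ℝ) : Set (Fin n → ℝ) :=
  Set.Icc a (fun i => a i + l)

/-- A weight: a locally integrable function on `ℝⁿ` that is positive almost everywhere. -/
def IsWeight {n : ℕ} (w : (Fin n → ℝ) → ℝ) : Prop :=
  LocallyIntegrable w volume ∧ ∀ᵐ x ∂(volume : Measure (Fin n → ℝ)), 0 < w x

/-- The `A_p` characteristic `[w]_{A_p}`, with values in `[0, ∞]`; `p / (p - 1)` is the conjugate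
exponent of `p`. -/
def apChar {n : ℕ} (p : ℝ) (w : (Fin n → ℝ) → ℝ) : ℝ≥0∞ :=
  ⨆ (a : Fin n → ℝ) (l : ℝ) (_ : 0 < l),
    (⨍⁻ x in cube a l, ENNReal.ofReal (w x) ∂volume) *
      (⨍⁻ x in cube a l, ENNReal.ofReal (w x ^ (1 - p / (p - 1))) ∂volume) ^ (p - 1)

/-- `w` is a Muckenhoupt `A_p` weight. -/
def IsAp {n : ℕ} (p : ℝ) (w : (Fin n → ℝ) → ℝ) : Prop :=
  IsWeight w ∧ apChar p w < ∞

/-- The `BMO` seminorm `‖f‖_*`, with values in `[0, ∞]`. -/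
def bmoNorm {n : ℕ} (f : (Fin n → ℝ) → ℝ) : ℝ≥0∞ :=
  ⨆ (a : Fin n → ℝ) (l : ℝ) (_ : 0 < l),
    ⨍⁻ x in cube a l, ‖f x - ⨍ y in cube a l, f y ∂volume‖ₑ ∂volume

/-- The distance `d_*(u, v) = ‖log u - log v‖_*`. -/
def dStar {n : ℕ} (u v : (Fin n → ℝ) → ℝ) : ℝ≥0∞ :=
  bmoNorm (fun x => Real.log (u x) - Real.log (v x))

/-- The measure `w dx`, so that `L^p(w)` is the `L^p` space of this measure. -/
def wMeasure {n : ℕ} (w : (Fin n → ℝ) → ℝ) : Measure (Fin n → ℝ) :=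
  volume.withDensity (fun x => ENNReal.ofReal (w x))

/-- Sublinearity of an operator `T` defined on a vector space `D` of (classes of a.e. equal)
measurable functions. -/
def IsSublinear {𝕜 : Type*} [RCLike 𝕜] {n : ℕ} {D : Submodule 𝕜 ((Fin n → ℝ) →ₘ[volume] 𝕜)}
    (T : D → ((Fin n → ℝ) →ₘ[volume] 𝕜)) : Prop :=
  (∀ f g : D, ∀ᵐ x ∂(volume : Measure (Fin n → ℝ)), ‖T (f + g) x‖ ≤ ‖T f x‖ + ‖T g x‖) ∧
  (∀ (k : 𝕜) (f : D), ∀ᵐ x ∂(volume : Measure (Fin n → ℝ)), ‖T (k • f) x‖ = ‖k‖ * ‖T f x‖)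

/-- The operator norm `‖T‖_{L^p(w) → L^p(w)}`, with values in `[0, ∞]`: the least `K` such that
`‖T f‖_{L^p(w)} ≤ K ‖f‖_{L^p(w)}` for the `f` in `L^p(w)`. -/
def opNorm {𝕜 : Type*} [RCLike 𝕜] {n : ℕ} {D : Submodule 𝕜 ((Fin n → ℝ) →ₘ[volume] 𝕜)}
    (T : D → ((Fin n → ℝ) →ₘ[volume] 𝕜)) (p : ℝ) (w : (Fin n → ℝ) → ℝ) : ℝ≥0∞ :=
  sInf {K : ℝ≥0∞ | ∀ f : D,
    MemLp (f : (Fin n → ℝ) →ₘ[volume] 𝕜) (ENNReal.ofReal p) (wMeasure w) →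
      eLpNorm (T f) (ENNReal.ofReal p) (wMeasure w) ≤
        K * eLpNorm (f : (Fin n → ℝ) →ₘ[volume] 𝕜) (ENNReal.ofReal p) (wMeasure w)}

/-- The weighted estimate: for every `A_p` weight `w`, the operator `T` is defined on all of
`L^p(w)`, and `‖T‖_{L^p(w) → L^p(w)} ≤ c F([w]_{A_p})`. -/
def WeightedBound {𝕜 : Type*} [RCLike 𝕜] {n : ℕ} {D : Submodule 𝕜 ((Fin n → ℝ) →ₘ[volume] 𝕜)}
    (T : D → ((Fin n → ℝ) →ₘ[volume] 𝕜)) (p c : ℝ) (F : ℝ → ℝ) : Prop :=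
  ∀ w : (Fin n → ℝ) → ℝ, IsAp p w →
    (∀ f : (Fin n → ℝ) →ₘ[volume] 𝕜, MemLp f (ENNReal.ofReal p) (wMeasure w) → f ∈ D) ∧
    opNorm T p w ≤ ENNReal.ofReal (c * F (apChar p w).toReal)

end WeightedContinuity

end

noncomputable section

namespace WeightedContinuity

variable {n : ℕ}

/-! ### Cubes -/

/-! The proof interpolates between `w₀` and a weight farther out on the logarithmic line through
`w₀` and `w`. Write `w = w₀ exp u` with `‖u‖_* ≤ θε`. Then `w` is the geometric mean, with exponents
`1 - θ` and `θ`, of `w₀` and `w₀ exp (u / θ)`. The far weight is a perturbation of `w₀` by a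
function of `BMO` norm at most `ε`, so it is still in `A_p`, with characteristic bounded in terms of
`n`, `p`, `[w₀]` only, and (H) bounds the norm of `T` there by a constant `M`. Interpolation with
change of measure gives `‖T‖_w ≤ ‖T‖_{w₀}^(1-θ) M^θ`. Exchanging the roles of `w` and `w₀` gives the
reverse inequality, with far weight `w₀ exp ((1 - 1/θ) u)`, which is again controlled by `[w₀]`
alone. Both claims follow by the inequality of geometric and arithmetic means; see
`exists_opNorm_le_of_dStar_le`.

Two ingredients carry this. The perturbation result `exists_isAp_mul_exp` comes from an exponential
John–Nirenberg inequality, `lintegral_exp_abs_sub_cubeAvg_le`, taken directly with respect to `w dx`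
and its dual measure; a Calderón–Zygmund stopping argument proves it once half of a cube is known to
carry a fixed proportion of the measure, so no reverse Hölder inequality is needed.

The interpolation result `opNorm_le_interpolation` must cover sublinear operators and lose no
constant, since any factor above `1` would destroy continuity. It uses the real method with the
functional `‖f₀‖^p + e^s ‖f₁‖^p`, whose minimum over splittings `f = f₀ + f₁` is explicit and
pointwise. Integrating in `s` against `e^(-θs)` recovers the intermediate weighted norm times
`interpConst`, which is the same on both sides and cancels. -/

/-- The half-open cube with lower corner `a` and side length `l`. -/
def halfOpenCube (a : Fin n → ℝ) (l : ℝ) : Set (Fin n → ℝ) :=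
  Set.univ.pi fun i => Set.Ico (a i) (a i + l)

/-- The average of `g` over a cube. -/
def cubeAvg (g : (Fin n → ℝ) → ℝ) (a : Fin n → ℝ) (l : ℝ) : ℝ :=
  ⨍ y in cube a l, g y ∂volume

theorem mem_halfOpenCube {a x : Fin n → ℝ} {l : ℝ} :
    x ∈ halfOpenCube a l ↔ ∀ i, a i ≤ x i ∧ x i < a i + l := by
  simp [halfOpenCube, Set.mem_pi]

theorem measurableSet_halfOpenCube (a : Fin n → ℝ) (l : ℝ) : MeasurableSet (halfOpenCube a l) :=
  MeasurableSet.univ_pi fun _ => measurableSet_Ico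

theorem halfOpenCube_ae_eq (a : Fin n → ℝ) (l : ℝ) :
    halfOpenCube a l =ᵐ[volume] cube a l :=
  Measure.univ_pi_Ico_ae_eq_Icc

theorem measurableSet_cube (a : Fin n → ℝ) (l : ℝ) : MeasurableSet (cube a l) :=
  measurableSet_Icc

theorem isCompact_cube (a : Fin n → ℝ) (l : ℝ) : IsCompact (cube a l) := isCompact_Icc

theorem volume_cube (a : Fin n → ℝ) (l : ℝ) : volume (cube a l) = ENNReal.ofReal l ^ n := by
  simp [cube, Real.volume_Icc_pi]

theorem volume_cube_ne_zero (a : Fin n → ℝ) {l : ℝ} (hl : 0 < l) : volume (cube a l) ≠ 0 := by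
  rw [volume_cube]
  exact pow_ne_zero _ (by simpa using hl)

theorem volume_cube_ne_top (a : Fin n → ℝ) (l : ℝ) : volume (cube a l) ≠ ∞ :=
  (isCompact_cube a l).measure_lt_top.ne

theorem closedBall_eq_cube (x : Fin n → ℝ) {r : ℝ} (hr : 0 ≤ r) :
    Metric.closedBall x r = cube (fun i => x i - r) (2 * r) := by
  ext y
  rw [Metric.mem_closedBall, dist_pi_le_iff hr, cube, Set.mem_Icc, Pi.le_def, Pi.le_def,
    ← forall_and]
  refine forall_congr' fun i => ?_
  rw [Real.dist_eq, abs_le]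
  constructor <;> rintro ⟨h1, h2⟩ <;> constructor <;> linarith

theorem cube_eq_closedBall (a : Fin n → ℝ) {l : ℝ} (hl : 0 ≤ l) :
    cube a l = Metric.closedBall (fun i => a i + l / 2) (l / 2) := by
  rw [closedBall_eq_cube _ (by positivity)]
  congr 1
  · ext i; ring
  · ring

/-- A function is locally integrable as soon as its integrals over cubes are finite. -/
theorem locallyIntegrable_of_lintegral_cube {g : (Fin n → ℝ) → ℝ}
    (hg : AEStronglyMeasurable g volume)
    (h : ∀ (a : Fin n → ℝ) (l : ℝ), 0 < l → ∫⁻ x in cube a l, ‖g x‖ₑ < ∞) :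
    LocallyIntegrable g volume := by
  rw [locallyIntegrable_iff]
  intro k hk
  obtain ⟨r, hr⟩ := hk.isBounded.subset_closedBall 0
  have hr' : k ⊆ cube (fun i => (0 : Fin n → ℝ) i - (|r| + 1)) (2 * (|r| + 1)) := by
    rw [← closedBall_eq_cube _ (by positivity)]
    exact hr.trans (Metric.closedBall_subset_closedBall (by linarith [le_abs_self r]))
  exact IntegrableOn.mono_set ⟨hg.restrict, h _ _ (by positivity)⟩ hr'

theorem _root_.MeasureTheory.LocallyIntegrable.integrableOn_cube {g : (Fin n → ℝ) → ℝ}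
    (hg : LocallyIntegrable g volume) (a : Fin n → ℝ) (l : ℝ) : IntegrableOn g (cube a l) volume :=
  hg.integrableOn_isCompact (isCompact_cube a l)

/-! ### Averages and mean oscillation -/

theorem enorm_cubeAvg_sub_mul_volume_le {g : (Fin n → ℝ) → ℝ} (hg : LocallyIntegrable g volume)
    (a : Fin n → ℝ) {l : ℝ} (hl : 0 < l) (c : ℝ) :
    ‖cubeAvg g a l - c‖ₑ * volume (cube a l) ≤ ∫⁻ x in cube a l, ‖g x - c‖ₑ := by
  have h0 := volume_cube_ne_zero a hl
  have ht := volume_cube_ne_top a l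
  have hgi : Integrable g (volume.restrict (cube a l)) := hg.integrableOn_cube a l
  have hci : Integrable (fun _ => c) (volume.restrict (cube a l)) :=
    integrableOn_const ht
  have hr : volume.real (cube a l) ≠ 0 := (ENNReal.toReal_pos h0 ht).ne'
  have h1 : volume.real (cube a l) * (cubeAvg g a l - c) = ∫ x in cube a l, (g x - c) := by
    rw [integral_sub hgi hci, setIntegral_const, cubeAvg, setAverage_eq, smul_eq_mul, smul_eq_mul]
    field_simp
  have h2 : volume (cube a l) = ‖volume.real (cube a l)‖ₑ := by
    rw [Real.enorm_eq_ofReal measureReal_nonneg, ofReal_measureReal ht]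
  rw [h2, mul_comm, ← enorm_mul, h1]
  exact enorm_integral_le_lintegral_enorm _

/-- `g` has mean oscillation at most `ε` on every cube. -/
theorem lintegral_le_of_bmoNorm_le {g : (Fin n → ℝ) → ℝ} {ε : ℝ≥0∞} (h : bmoNorm g ≤ ε)
    (a : Fin n → ℝ) {l : ℝ} (hl : 0 < l) :
    ∫⁻ x in cube a l, ‖g x - cubeAvg g a l‖ₑ ≤ ε * volume (cube a l) := by
  have h1 : (⨍⁻ x in cube a l, ‖g x - cubeAvg g a l‖ₑ ∂volume) ≤ ε :=
    iSup_le_iff.1 (iSup_le_iff.1 (iSup_le_iff.1 h a) l) hl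
  rw [setLAverage_eq] at h1
  exact (ENNReal.div_le_iff (volume_cube_ne_zero a hl) (volume_cube_ne_top a l)).1 h1

/-- The factor `2 ^ n` is the ratio of the two volumes: the oscillation on the large cube dominates
the integral over the small one. -/
theorem abs_cubeAvg_sub_le_of_subset {g : (Fin n → ℝ) → ℝ} (hg : LocallyIntegrable g volume)
    {ε : ℝ} (hε : 0 ≤ ε) (hb : bmoNorm g ≤ ENNReal.ofReal ε) {a b : Fin n → ℝ} {l : ℝ}
    (hl : 0 < l) (hab : cube b l ⊆ cube a (2 * l)) :
    |cubeAvg g b l - cubeAvg g a (2 * l)| ≤ 2 ^ n * ε := by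
  have h1 := (enorm_cubeAvg_sub_mul_volume_le hg b hl (cubeAvg g a (2 * l))).trans
    ((lintegral_mono_set hab).trans (lintegral_le_of_bmoNorm_le hb a (by positivity)))
  rw [volume_cube, volume_cube, ENNReal.ofReal_mul (by norm_num), mul_pow, ← mul_assoc] at h1
  have h2 := (ENNReal.mul_le_mul_iff_left (pow_ne_zero n (by simpa using hl))
    (ENNReal.pow_ne_top ENNReal.ofReal_ne_top)).1 h1
  rw [Real.enorm_eq_ofReal_abs, ← ENNReal.ofReal_pow (by norm_num),
    ← ENNReal.ofReal_mul hε, ENNReal.ofReal_le_ofReal_iff (by positivity)] at h2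
  linarith

/-! ### Dyadic subcubes -/

/-- The index of the dyadic subcube of generation `k` that contains `x`. -/
def dyadicIndex (a : Fin n → ℝ) (l : ℝ) (k : ℕ) (x : Fin n → ℝ) : Fin n → ℤ :=
  fun i => ⌊(x i - a i) * 2 ^ k / l⌋

/-- The lower corner of the dyadic subcube of generation `k` and index `m`. -/
def dyadicCorner (a : Fin n → ℝ) (l : ℝ) (k : ℕ) (m : Fin n → ℤ) : Fin n → ℝ :=
  fun i => a i + m i * (l / 2 ^ k)

theorem mem_halfOpenCube_dyadic {a x : Fin n → ℝ} {l : ℝ} (hl : 0 < l) {k : ℕ}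
    {m : Fin n → ℤ} :
    x ∈ halfOpenCube (dyadicCorner a l k m) (l / 2 ^ k) ↔ dyadicIndex a l k x = m := by
  rw [mem_halfOpenCube, funext_iff]
  refine forall_congr' fun i => ?_
  have h2 : (0 : ℝ) < 2 ^ k := by positivity
  rw [dyadicIndex, Int.floor_eq_iff, le_div_iff₀ hl, div_lt_iff₀ hl, dyadicCorner]
  have e : ((m i : ℝ) * (l / 2 ^ k)) * 2 ^ k = m i * l := by field_simp
  have e' : (l / 2 ^ k) * 2 ^ k = l := by field_simp
  refine and_congr ?_ ?_
  · rw [← mul_le_mul_iff_left₀ h2]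
    constructor <;> intro h <;> nlinarith
  · rw [← mul_lt_mul_iff_left₀ h2]
    constructor <;> intro h <;> nlinarith

theorem dyadicIndex_succ (a x : Fin n → ℝ) (l : ℝ) (k : ℕ) (i : Fin n) :
    dyadicIndex a l k x i = dyadicIndex a l (k + 1) x i / 2 := by
  have := Int.floor_div_natCast ((x i - a i) * 2 ^ (k + 1) / l) 2
  simp only [dyadicIndex]
  push_cast at this
  rw [← this]
  congr 1
  ring

theorem dyadicIndex_eq_of_le {a x y : Fin n → ℝ} {l : ℝ} {j k : ℕ} (hjk : j ≤ k)
    (h : dyadicIndex a l k x = dyadicIndex a l k y) :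
    dyadicIndex a l j x = dyadicIndex a l j y := by
  induction k, hjk using Nat.le_induction with
  | base => exact h
  | succ k _ ih =>
    refine ih (funext fun i => ?_)
    rw [dyadicIndex_succ, dyadicIndex_succ a y, h]

theorem dyadicCorner_zero (a : Fin n → ℝ) (l : ℝ) : dyadicCorner a l 0 0 = a := by
  ext i; simp [dyadicCorner]

theorem cube_dyadic_subset {a x : Fin n → ℝ} {l : ℝ} (hl : 0 < l) (k : ℕ) :
    cube (dyadicCorner a l (k + 1) (dyadicIndex a l (k + 1) x)) (l / 2 ^ (k + 1)) ⊆
      cube (dyadicCorner a l k (dyadicIndex a l k x)) (2 * (l / 2 ^ (k + 1))) := by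
  have hs : 0 < l / 2 ^ (k + 1) := by positivity
  set s := l / 2 ^ (k + 1) with hsdef
  have e : l / 2 ^ k = 2 * s := by rw [hsdef, pow_succ]; field_simp
  refine Set.Icc_subset_Icc (fun i => ?_) (fun i => ?_) <;>
  · have h1 : dyadicIndex a l k x i = dyadicIndex a l (k + 1) x i / 2 := dyadicIndex_succ a x l k i
    simp only [dyadicCorner, e]
    rw [← hsdef]
    have h2 : 2 * dyadicIndex a l k x i ≤ dyadicIndex a l (k + 1) x i ∧
      dyadicIndex a l (k + 1) x i ≤ 2 * dyadicIndex a l k x i + 1 := by omega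
    obtain ⟨h3, h4⟩ := h2
    have h3' : 2 * (dyadicIndex a l k x i : ℝ) ≤ dyadicIndex a l (k + 1) x i := by exact_mod_cast h3
    have h4' : (dyadicIndex a l (k + 1) x i : ℝ) ≤ 2 * dyadicIndex a l k x i + 1 := by
      exact_mod_cast h4
    nlinarith

/-- The averages over the dyadic cubes that contain `x` converge to the value at almost every
`x`. -/
theorem ae_tendsto_cubeAvg_dyadic {g : (Fin n → ℝ) → ℝ} (hg : LocallyIntegrable g volume)
    (a : Fin n → ℝ) {l : ℝ} (hl : 0 < l) :
    ∀ᵐ x, Tendsto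
      (fun k => cubeAvg g (dyadicCorner a l k (dyadicIndex a l k x)) (l / 2 ^ k)) atTop
      (𝓝 (g x)) := by
  -- Cubes are closed balls of the sup norm, so Lebesgue differentiation applies with balls that
  -- contain `x` without being centred there; the parameter `1` allows exactly this.
  filter_upwards [IsUnifLocDoublingMeasure.ae_tendsto_average volume hg 1] with x hx
  have hlim : Tendsto (fun k : ℕ => l / 2 ^ k / 2) atTop (𝓝[>] 0) := by
    refine tendsto_nhdsWithin_iff.2 ⟨?_, Eventually.of_forall fun k => ?_⟩
    · have := (tendsto_pow_atTop_nhds_zero_of_lt_one (r := (1 / 2 : ℝ)) (by norm_num)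
        (by norm_num)).const_mul (l / 2)
      rw [mul_zero] at this
      refine this.congr fun k => ?_
      rw [one_div, inv_pow]; ring
    · simp only [Set.mem_Ioi]; positivity
  have := hx (fun k i => dyadicCorner a l k (dyadicIndex a l k x) i + l / 2 ^ k / 2) _ hlim
    (Eventually.of_forall fun k => by
      rw [one_mul, ← cube_eq_closedBall _ (by positivity)]
      have h := (mem_halfOpenCube.1 ((mem_halfOpenCube_dyadic (a := a) (x := x) hl (k := k)).2 rfl))
      exact ⟨fun i => (h i).1, fun i => (h i).2.le⟩)
  refine this.congr fun k => ?_
  rw [cubeAvg, cube_eq_closedBall _ (by positivity)]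

/-- Calderón–Zygmund stopping cubes for the averages of a function of small mean oscillation. -/
theorem exists_stopping_cubes {g : (Fin n → ℝ) → ℝ} (hg : LocallyIntegrable g volume)
    {ε : ℝ} (hε : 0 ≤ ε) (hb : bmoNorm g ≤ ENNReal.ofReal ε) (a : Fin n → ℝ) {l : ℝ}
    (hl : 0 < l) :
    ∃ (ι : Type) (_ : Countable ι) (b : ι → Fin n → ℝ) (s : ι → ℝ),
      (∀ i, 0 < s i) ∧ (∀ i, halfOpenCube (b i) (s i) ⊆ halfOpenCube a l) ∧
      Pairwise (Function.onFun Disjoint fun i => halfOpenCube (b i) (s i)) ∧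
      (∀ i, 2 * ε < |cubeAvg g (b i) (s i) - cubeAvg g a l|) ∧
      (∀ i, |cubeAvg g (b i) (s i) - cubeAvg g a l| ≤ (2 ^ n + 2) * ε) ∧
      ∀ᵐ x, x ∈ halfOpenCube a l → (∀ i, x ∉ halfOpenCube (b i) (s i)) →
        |g x - cubeAvg g a l| ≤ 2 * ε := by
  let bad : ℕ → (Fin n → ℤ) → Prop := fun k m =>
    2 * ε < |cubeAvg g (dyadicCorner a l k m) (l / 2 ^ k) - cubeAvg g a l|
  -- Points of the cube whose first bad generation is `q.1`, sorted by the dyadic cube of that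
  -- generation. Badness depends only on the dyadic cubes, so a nonempty `S q` is a whole dyadic
  -- cube.
  let S : ℕ × (Fin n → ℤ) → Set (Fin n → ℝ) := fun q => {x | dyadicIndex a l 0 x = 0 ∧
    dyadicIndex a l q.1 x = q.2 ∧ bad q.1 q.2 ∧ ∀ j < q.1, ¬ bad j (dyadicIndex a l j x)}
  have hS : ∀ q, (S q).Nonempty →
      halfOpenCube (dyadicCorner a l q.1 q.2) (l / 2 ^ q.1) = S q := by
    rintro q ⟨y, hy0, hyk, hbad, hy⟩
    ext x
    rw [mem_halfOpenCube_dyadic hl]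
    refine ⟨fun hx => ?_, fun hx => hx.2.1⟩
    have hxy : ∀ j ≤ q.1, dyadicIndex a l j x = dyadicIndex a l j y := fun j hj =>
      dyadicIndex_eq_of_le hj (hx.trans hyk.symm)
    refine ⟨(hxy 0 (Nat.zero_le _)).trans hy0, hx, hbad, fun j hj => ?_⟩
    rw [hxy j hj.le]
    exact hy j hj
  have h0 : ∀ x, x ∈ halfOpenCube a l ↔ dyadicIndex a l 0 x = 0 := by
    intro x
    have := mem_halfOpenCube_dyadic (a := a) (x := x) hl (k := 0) (m := 0)
    rwa [dyadicCorner_zero, pow_zero, div_one] at this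
  refine ⟨{q // (S q).Nonempty}, inferInstance, fun q => dyadicCorner a l q.1.1 q.1.2,
    fun q => l / 2 ^ q.1.1, fun q => by positivity, ?_, ?_, ?_, ?_, ?_⟩
  · intro q x hx
    rw [hS _ q.2] at hx
    exact (h0 x).2 hx.1
  · intro q q' hne
    rw [Function.onFun, hS _ q.2, hS _ q'.2, Set.disjoint_left]
    intro x hx hx'
    apply hne
    have hk : q.1.1 = q'.1.1 := by
      rcases lt_trichotomy q.1.1 q'.1.1 with h | h | h
      · exact absurd (by rw [hx.2.1]; exact hx.2.2.1) (hx'.2.2.2 _ h)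
      · exact h
      · exact absurd (by rw [hx'.2.1]; exact hx'.2.2.1) (hx.2.2.2 _ h)
    exact Subtype.ext (Prod.ext hk (by rw [← hx.2.1, ← hx'.2.1, hk]))
  · rintro ⟨q, y, hy⟩
    exact hy.2.2.1
  · rintro ⟨⟨k, m⟩, y, hy0, hyk, hbad, hy⟩
    cases k with
    -- Generation `0` is the original cube, whose average does not deviate from itself; hence every
    -- stopping cube has a parent, and that parent is good.
    | zero =>
      exfalso
      simp only at hyk hbad
      have hm : m = 0 := by rw [← hyk, hy0]
      subst hm
      simp only [bad, dyadicCorner_zero, pow_zero, div_one, sub_self, abs_zero] at hbad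
      linarith
    | succ k =>
      simp only at hyk hbad hy ⊢
      have h1 : ¬ bad k (dyadicIndex a l k y) := hy k (Nat.lt_succ_self k)
      have hs : (0 : ℝ) < l / 2 ^ (k + 1) := by positivity
      have e : l / 2 ^ k = 2 * (l / 2 ^ (k + 1)) := by rw [pow_succ]; field_simp
      have h2 := abs_cubeAvg_sub_le_of_subset hg hε hb hs
        (cube_dyadic_subset (a := a) (x := y) hl k)
      simp only [bad, not_lt, e] at h1
      rw [hyk] at h2
      have h3 := abs_sub_le (cubeAvg g (dyadicCorner a l (k + 1) m) (l / 2 ^ (k + 1)))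
        (cubeAvg g (dyadicCorner a l k (dyadicIndex a l k y)) (2 * (l / 2 ^ (k + 1))))
        (cubeAvg g a l)
      linarith
  · filter_upwards [ae_tendsto_cubeAvg_dyadic hg a hl] with x hx hxQ hxn
    have hgood : ∀ k, ¬ bad k (dyadicIndex a l k x) := by
      by_contra! hex
      classical
      have hmin := Nat.find_spec hex
      have hlt : ∀ j < Nat.find hex, ¬ bad j (dyadicIndex a l j x) := fun j hj =>
        Nat.find_min hex hj
      set k := Nat.find hex
      have hxS : x ∈ S (k, dyadicIndex a l k x) := ⟨(h0 x).1 hxQ, rfl, hmin, hlt⟩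
      exact hxn ⟨(k, dyadicIndex a l k x), x, hxS⟩ ((mem_halfOpenCube_dyadic hl).2 rfl)
    have hlim := (hx.sub_const (cubeAvg g a l)).abs
    exact le_of_tendsto hlim (Eventually.of_forall fun k => not_lt.1 (hgood k))

/-! ### A John–Nirenberg inequality for measures in the class `A_∞` -/

/-- Subsets of at most half of a cube carry at most the fraction `β` of its `μ`-measure. -/
def HalfProportion (μ : Measure (Fin n → ℝ)) (β : ℝ) : Prop :=
  ∀ (a : Fin n → ℝ) (l : ℝ), 0 < l → ∀ E : Set (Fin n → ℝ), MeasurableSet E → E ⊆ cube a l →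
    2 * volume E ≤ volume (cube a l) → μ E ≤ ENNReal.ofReal β * μ (cube a l)

/-- Chebyshev: each stopping cube contributes at least `2ε` times its volume to an integral that is
at most `ε * volume (cube a l)`. The threshold `2ε` is chosen to produce the proportion one half. -/
theorem two_mul_volume_iUnion_stopping_le {g : (Fin n → ℝ) → ℝ}
    (hg : LocallyIntegrable g volume) {ε : ℝ} (hε : 0 < ε) (hb : bmoNorm g ≤ ENNReal.ofReal ε)
    {a : Fin n → ℝ} {l : ℝ} (hl : 0 < l) {ι : Type} [Countable ι] {b : ι → Fin n → ℝ}
    {s : ι → ℝ} (hs : ∀ i, 0 < s i) (hsub : ∀ i, halfOpenCube (b i) (s i) ⊆ halfOpenCube a l)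
    (hdisj : Pairwise (Function.onFun Disjoint fun i => halfOpenCube (b i) (s i)))
    (hlow : ∀ i, 2 * ε < |cubeAvg g (b i) (s i) - cubeAvg g a l|) :
    2 * volume (⋃ i, halfOpenCube (b i) (s i)) ≤ volume (cube a l) := by
  have hm : ∀ i, MeasurableSet (halfOpenCube (b i) (s i)) := fun i => measurableSet_halfOpenCube _ _
  have h1 : ENNReal.ofReal (2 * ε) * volume (⋃ i, halfOpenCube (b i) (s i)) ≤
      ENNReal.ofReal ε * volume (cube a l) := by
    calc ENNReal.ofReal (2 * ε) * volume (⋃ i, halfOpenCube (b i) (s i))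
        = ∑' i, ENNReal.ofReal (2 * ε) * volume (halfOpenCube (b i) (s i)) := by
          rw [measure_iUnion hdisj hm, ENNReal.tsum_mul_left]
      _ ≤ ∑' i, ∫⁻ x in halfOpenCube (b i) (s i), ‖g x - cubeAvg g a l‖ₑ := by
          refine ENNReal.tsum_le_tsum fun i => ?_
          rw [measure_congr (halfOpenCube_ae_eq (b i) (s i)),
            Measure.restrict_congr_set (halfOpenCube_ae_eq (b i) (s i))]
          refine le_trans ?_ (enorm_cubeAvg_sub_mul_volume_le hg (b i) (hs i) _)
          gcongr
          rw [Real.enorm_eq_ofReal_abs]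
          exact ENNReal.ofReal_le_ofReal (hlow i).le
      _ = ∫⁻ x in ⋃ i, halfOpenCube (b i) (s i), ‖g x - cubeAvg g a l‖ₑ :=
          (lintegral_iUnion hm hdisj _).symm
      _ ≤ ∫⁻ x in halfOpenCube a l, ‖g x - cubeAvg g a l‖ₑ :=
          lintegral_mono_set (Set.iUnion_subset hsub)
      _ ≤ ENNReal.ofReal ε * volume (cube a l) := by
          rw [Measure.restrict_congr_set (halfOpenCube_ae_eq a l)]
          exact lintegral_le_of_bmoNorm_le hb a hl
  rw [ENNReal.ofReal_mul (by norm_num), mul_comm (ENNReal.ofReal 2), mul_assoc] at h1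
  simpa using (ENNReal.mul_le_mul_iff_right (by simpa using hε) ENNReal.ofReal_ne_top).1 h1

/-- One pass of the stopping argument turns a bound `K` valid on all cubes into an affine function
of `K` with slope `β exp ((2 ^ n + 2) ε)`. Off the stopping cubes the deviation is at most `2ε`; on
each of them the reference average shifts by at most `(2 ^ n + 2) ε`, and together they carry at
most the fraction `β` of the measure. -/
theorem lintegral_exp_trunc_step {μ : Measure (Fin n → ℝ)} (hμ : μ ≪ volume) {β : ℝ}
    (hβ0 : 0 ≤ β) (hβ : HalfProportion μ β) {g : (Fin n → ℝ) → ℝ}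
    (hg : LocallyIntegrable g volume) {ε : ℝ} (hε : 0 < ε) (hb : bmoNorm g ≤ ENNReal.ofReal ε)
    {N K : ℝ} (hK0 : 0 ≤ K)
    (hK : ∀ (a : Fin n → ℝ) (l : ℝ), 0 < l →
      ∫⁻ x in cube a l, ENNReal.ofReal (Real.exp (min |g x - cubeAvg g a l| N)) ∂μ ≤
        ENNReal.ofReal K * μ (cube a l))
    (a : Fin n → ℝ) {l : ℝ} (hl : 0 < l) :
    ∫⁻ x in cube a l, ENNReal.ofReal (Real.exp (min |g x - cubeAvg g a l| N)) ∂μ ≤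
      ENNReal.ofReal (Real.exp (2 * ε) + β * Real.exp ((2 ^ n + 2) * ε) * K) * μ (cube a l) := by
  obtain ⟨ι, _, b, s, hs, hsub, hdisj, hlow, hup, hae⟩ := exists_stopping_cubes hg hε.le hb a hl
  have hm : ∀ i, MeasurableSet (halfOpenCube (b i) (s i)) := fun i => measurableSet_halfOpenCube _ _
  have hcube : ∀ (a : Fin n → ℝ) (l : ℝ), halfOpenCube a l =ᵐ[μ] cube a l := fun a l =>
    hμ.ae_le (halfOpenCube_ae_eq a l)
  have hvol := two_mul_volume_iUnion_stopping_le hg hε hb hl hs hsub hdisj hlow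
  set E := ⋃ i, halfOpenCube (b i) (s i) with hE
  have hEm : MeasurableSet E := MeasurableSet.iUnion hm
  have hEQ : E ⊆ halfOpenCube a l := Set.iUnion_subset hsub
  have hQc : halfOpenCube a l ⊆ cube a l := fun x hx =>
    ⟨fun i => (mem_halfOpenCube.1 hx i).1, fun i => (mem_halfOpenCube.1 hx i).2.le⟩
  set φ : (Fin n → ℝ) → ℝ≥0∞ := fun x =>
    ENNReal.ofReal (Real.exp (min |g x - cubeAvg g a l| N)) with hφ
  have hgood : ∫⁻ x in halfOpenCube a l \ E, φ x ∂μ ≤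
      ENNReal.ofReal (Real.exp (2 * ε)) * μ (cube a l) := by
    calc ∫⁻ x in halfOpenCube a l \ E, φ x ∂μ
        ≤ ∫⁻ x in halfOpenCube a l \ E, ENNReal.ofReal (Real.exp (2 * ε)) ∂μ := by
          refine setLIntegral_mono_ae' ((measurableSet_halfOpenCube a l).diff hEm) ?_
          filter_upwards [hμ.ae_le hae] with x hx hxE
          refine ENNReal.ofReal_le_ofReal (Real.exp_le_exp.2 ((min_le_left _ _).trans ?_))
          exact hx hxE.1 fun i hi => hxE.2 (Set.mem_iUnion.2 ⟨i, hi⟩)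
      _ = ENNReal.ofReal (Real.exp (2 * ε)) * μ (halfOpenCube a l \ E) := setLIntegral_const _ _
      _ ≤ _ := by gcongr; exact Set.sdiff_subset.trans hQc
  have hbad : ∫⁻ x in E, φ x ∂μ ≤
      ENNReal.ofReal (β * Real.exp ((2 ^ n + 2) * ε) * K) * μ (cube a l) := by
    calc ∫⁻ x in E, φ x ∂μ = ∑' i, ∫⁻ x in halfOpenCube (b i) (s i), φ x ∂μ :=
          lintegral_iUnion hm hdisj _
      _ ≤ ∑' i, ENNReal.ofReal (Real.exp ((2 ^ n + 2) * ε)) *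
            (ENNReal.ofReal K * μ (halfOpenCube (b i) (s i))) := by
          refine ENNReal.tsum_le_tsum fun i => ?_
          rw [measure_congr (hcube (b i) (s i)), Measure.restrict_congr_set (hcube (b i) (s i))]
          refine le_trans ?_ (mul_le_mul_right (hK (b i) (s i) (hs i)) _)
          rw [← lintegral_const_mul' _ _ ENNReal.ofReal_ne_top]
          refine lintegral_mono fun x => ?_
          rw [← ENNReal.ofReal_mul (Real.exp_pos _).le, ← Real.exp_add]
          refine ENNReal.ofReal_le_ofReal (Real.exp_le_exp.2 ?_)
          have h1 := abs_sub_le (g x) (cubeAvg g (b i) (s i)) (cubeAvg g a l)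
          have h2 := hup i
          have h3 : 0 ≤ (2 ^ n + 2) * ε := by positivity
          rw [← min_add_add_left]
          exact min_le_min (by linarith) (by linarith)
      _ = ENNReal.ofReal (Real.exp ((2 ^ n + 2) * ε)) * (ENNReal.ofReal K * μ E) := by
          rw [ENNReal.tsum_mul_left, ENNReal.tsum_mul_left, ← measure_iUnion hdisj hm]
      _ ≤ ENNReal.ofReal (Real.exp ((2 ^ n + 2) * ε)) *
            (ENNReal.ofReal K * (ENNReal.ofReal β * μ (cube a l))) := by
          gcongr
          exact hβ a l hl E hEm (hEQ.trans hQc) hvol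
      _ = _ := by
          rw [ENNReal.ofReal_mul (by positivity), ENNReal.ofReal_mul hβ0]
          ring
  rw [← Measure.restrict_congr_set (hcube a l), ENNReal.ofReal_add (by positivity) (by positivity),
    add_mul, ← lintegral_inter_add_sdiff φ (halfOpenCube a l) hEm, Set.inter_eq_right.2 hEQ, add_comm]
  exact add_le_add hgood hbad

/-- The John–Nirenberg inequality in exponential form, with respect to an `A_∞` measure. -/
theorem lintegral_exp_abs_sub_cubeAvg_le {μ : Measure (Fin n → ℝ)} (hμ : μ ≪ volume) {β : ℝ}
    (hβ0 : 0 ≤ β) (hβ : HalfProportion μ β) {g : (Fin n → ℝ) → ℝ}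
    (hg : LocallyIntegrable g volume) {ε : ℝ} (hε : 0 < ε) (hb : bmoNorm g ≤ ENNReal.ofReal ε)
    (hq : β * Real.exp ((2 ^ n + 2) * ε) < 1) (a : Fin n → ℝ) {l : ℝ} (hl : 0 < l) :
    ∫⁻ x in cube a l, ENNReal.ofReal (Real.exp |g x - cubeAvg g a l|) ∂μ ≤
      ENNReal.ofReal (Real.exp (2 * ε) / (1 - β * Real.exp ((2 ^ n + 2) * ε))) *
        μ (cube a l) := by
  set q := β * Real.exp ((2 ^ n + 2) * ε) with hqdef
  have hq0 : 0 ≤ q := by positivity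
  have h1q : 0 < 1 - q := by linarith
  -- The fixed point of the affine map. Truncation at `N` supplies a finite starting bound, the
  -- iterates contract to `L` since `q < 1`, and `L` does not depend on `N`.
  set L := Real.exp (2 * ε) / (1 - q) with hL
  have hL0 : 0 < L := by positivity
  have hfix : Real.exp (2 * ε) + q * L = L := by rw [hL]; field_simp; ring
  have hiter : ∀ (N : ℕ) (j : ℕ) (a : Fin n → ℝ) (l : ℝ), 0 < l →
      ∫⁻ x in cube a l, ENNReal.ofReal (Real.exp (min |g x - cubeAvg g a l| N)) ∂μ ≤
        ENNReal.ofReal (L + q ^ j * Real.exp N) * μ (cube a l) := by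
    intro N j
    induction j with
    | zero =>
      intro a l _
      rw [← setLIntegral_const]
      refine lintegral_mono fun x => ENNReal.ofReal_le_ofReal ?_
      have := Real.exp_le_exp.2 (min_le_right |g x - cubeAvg g a l| (N : ℝ))
      rw [pow_zero, one_mul]
      linarith
    | succ j ih =>
      intro a l hl
      have := lintegral_exp_trunc_step hμ hβ0 hβ hg hε hb (by positivity) ih a hl
      rw [← hqdef] at this
      convert this using 3
      rw [mul_add, ← add_assoc, hfix, pow_succ]
      ring
  have htrunc : ∀ N : ℕ,
      ∫⁻ x in cube a l, ENNReal.ofReal (Real.exp (min |g x - cubeAvg g a l| N)) ∂μ ≤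
        ENNReal.ofReal L * μ (cube a l) := by
    intro N
    have hlim : Tendsto (fun j : ℕ => ENNReal.ofReal (L + q ^ j * Real.exp N) * μ (cube a l))
        atTop (𝓝 (ENNReal.ofReal L * μ (cube a l))) := by
      refine ENNReal.Tendsto.mul_const ?_ (Or.inl (by simpa using hL0))
      refine ENNReal.tendsto_ofReal ?_
      simpa using ((tendsto_pow_atTop_nhds_zero_of_lt_one hq0 hq).mul_const (Real.exp N)).const_add L
    exact ge_of_tendsto' hlim fun j => hiter N j a l hl
  have hmeas : AEMeasurable g (μ.restrict (cube a l)) :=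
    (hg.aestronglyMeasurable.aemeasurable.mono_ac hμ).restrict
  refine le_of_tendsto' (lintegral_tendsto_of_tendsto_of_monotone
    (f := fun (N : ℕ) x => ENNReal.ofReal (Real.exp (min |g x - cubeAvg g a l| N)))
    (fun N => ?_) (Eventually.of_forall fun x => ?_) (Eventually.of_forall fun x => ?_)) htrunc
  · have : Measurable fun y : ℝ => ENNReal.ofReal (Real.exp (min |y - cubeAvg g a l| N)) := by
      fun_prop
    exact this.comp_aemeasurable hmeas
  · intro N M hNM
    exact ENNReal.ofReal_le_ofReal (Real.exp_le_exp.2 (min_le_min le_rfl (by exact_mod_cast hNM)))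
  · obtain ⟨M, hM⟩ := exists_nat_ge |g x - cubeAvg g a l|
    refine tendsto_const_nhds.congr' ?_
    filter_upwards [eventually_ge_atTop M] with N hN
    rw [min_eq_left (hM.trans (by exact_mod_cast hN))]

theorem exists_john_nirenberg_const (n : ℕ) {β : ℝ} (hβ0 : 0 ≤ β) (hβ1 : β < 1) :
    ∃ ε : ℝ, 0 < ε ∧ ∃ C : ℝ, 0 < C ∧ ∀ μ : Measure (Fin n → ℝ), μ ≪ volume →
      HalfProportion μ β → ∀ g : (Fin n → ℝ) → ℝ, LocallyIntegrable g volume →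
      bmoNorm g ≤ ENNReal.ofReal ε → ∀ (a : Fin n → ℝ) (l : ℝ), 0 < l →
      ∫⁻ x in cube a l, ENNReal.ofReal (Real.exp |g x - cubeAvg g a l|) ∂μ ≤
        ENNReal.ofReal C * μ (cube a l) := by
  have hlim : Tendsto (fun ε : ℝ => β * Real.exp ((2 ^ n + 2) * ε)) (𝓝[>] 0) (𝓝 β) := by
    have : Continuous fun ε : ℝ => β * Real.exp ((2 ^ n + 2) * ε) := by fun_prop
    simpa using (this.tendsto 0).mono_left nhdsWithin_le_nhds
  obtain ⟨ε, hq, hε⟩ := ((hlim.eventually (gt_mem_nhds hβ1)).and self_mem_nhdsWithin).exists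
  refine ⟨ε, hε, _, div_pos (Real.exp_pos (2 * ε)) (sub_pos.2 hq), ?_⟩
  intro μ hμ hβ g hg hb a l hl
  exact lintegral_exp_abs_sub_cubeAvg_le hμ hβ0 hβ hg hε hb hq a hl

/-! ### Pairs of dual weights -/

/-- Hölder's inequality for `1 = u^(1/p) v^(1/q)`. The pair is kept symmetric so that it serves both
a weight and its dual. -/
theorem volume_le_lintegral_rpow_mul {u v : (Fin n → ℝ) → ℝ≥0∞} {p q : ℝ}
    (hpq : p.HolderConjugate q) (hu : AEMeasurable u volume) (hv : AEMeasurable v volume)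
    (huv : ∀ᵐ x, u x ^ (1 / p) * v x ^ (1 / q) = 1) (F : Set (Fin n → ℝ)) :
    volume F ≤ (∫⁻ x in F, u x) ^ (1 / p) * (∫⁻ x in F, v x) ^ (1 / q) := by
  have h := ENNReal.lintegral_mul_le_Lp_mul_Lq (volume.restrict F) hpq
    (f := fun x => u x ^ (1 / p)) (g := fun x => v x ^ (1 / q))
    (hu.restrict.pow_const _) (hv.restrict.pow_const _)
  have e1 : ∀ x : ℝ≥0∞, (x ^ (1 / p)) ^ p = x := fun x => by
    rw [← ENNReal.rpow_mul, one_div_mul_cancel hpq.ne_zero, ENNReal.rpow_one]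
  have e2 : ∀ x : ℝ≥0∞, (x ^ (1 / q)) ^ q = x := fun x => by
    rw [← ENNReal.rpow_mul, one_div_mul_cancel hpq.symm.ne_zero, ENNReal.rpow_one]
  simp only [e1, e2] at h
  refine le_trans (le_of_eq ?_) h
  have h1 : ∫⁻ x in F, u x ^ (1 / p) * v x ^ (1 / q) = ∫⁻ _ in F, 1 :=
    lintegral_congr_ae (ae_restrict_of_ae huv)
  rw [setLIntegral_const, one_mul] at h1
  exact h1.symm

/-- The complement `F` of `E` fills at least half of `Q`. The `A_p` condition on `Q` against Hölder
on `F` gives `u(Q)^(1/p) v(Q)^(1/q) ≤ 2A u(F)^(1/p) v(Q)^(1/q)`; cancelling the `v` factor leaves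
`F` a fixed proportion of `u(Q)`. -/
theorem halfProportion_of_dual {u v : (Fin n → ℝ) → ℝ≥0∞} {p q : ℝ}
    (hpq : p.HolderConjugate q) (hu : AEMeasurable u volume) (hv : AEMeasurable v volume)
    (huv : ∀ᵐ x, u x ^ (1 / p) * v x ^ (1 / q) = 1) {A : ℝ} (hA : 1 ≤ A)
    (hut : ∀ (a : Fin n → ℝ) (l : ℝ), 0 < l → ∫⁻ x in cube a l, u x ≠ ∞)
    (hv0 : ∀ (a : Fin n → ℝ) (l : ℝ), 0 < l → ∫⁻ x in cube a l, v x ≠ 0)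
    (hvt : ∀ (a : Fin n → ℝ) (l : ℝ), 0 < l → ∫⁻ x in cube a l, v x ≠ ∞)
    (hap : ∀ (a : Fin n → ℝ) (l : ℝ), 0 < l →
      (∫⁻ x in cube a l, u x) ^ (1 / p) * (∫⁻ x in cube a l, v x) ^ (1 / q) ≤
        ENNReal.ofReal A * volume (cube a l)) :
    HalfProportion (volume.withDensity u) (1 - ((2 * A) ^ p)⁻¹) := by
  intro a l hl E hEm hE hhalf
  set Q := cube a l with hQ
  have hQm : MeasurableSet Q := measurableSet_cube a l
  set F := Q \ E with hF
  have hFm : MeasurableSet F := hQm.diff hEm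
  have hFQ : F ⊆ Q := Set.sdiff_subset
  rw [withDensity_apply _ hEm, withDensity_apply _ hQm]
  have hsplit : (∫⁻ x in E, u x) + ∫⁻ x in F, u x = ∫⁻ x in Q, u x := by
    rw [← lintegral_inter_add_sdiff u Q hEm, Set.inter_eq_right.2 hE]
  have hvol : volume Q ≤ 2 * volume F := by
    have h1 : volume E + volume F = volume Q := by
      rw [← measure_inter_add_sdiff Q hEm, Set.inter_eq_right.2 hE]
    have h2 : volume Q + volume Q ≤ volume Q + 2 * volume F := by
      calc volume Q + volume Q = 2 * volume E + 2 * volume F := by rw [← mul_add, h1, two_mul]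
        _ ≤ _ := by gcongr
    exact (ENNReal.add_le_add_iff_left (volume_cube_ne_top a l)).1 h2
  have hp := hpq.pos
  have hq := hpq.symm.pos
  have hVne : (∫⁻ x in Q, v x) ^ (1 / q) ≠ 0 := by
    simp [ENNReal.rpow_eq_zero_iff, hv0 a l hl, hvt a l hl, hQ]
  have hVnt : (∫⁻ x in Q, v x) ^ (1 / q) ≠ ∞ :=
    ENNReal.rpow_ne_top_of_nonneg (by positivity) (hvt a l hl)
  have h1 : (∫⁻ x in Q, u x) ^ (1 / p) ≤ ENNReal.ofReal (2 * A) * (∫⁻ x in F, u x) ^ (1 / p) := by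
    refine (ENNReal.mul_le_mul_iff_left hVne hVnt).1 ?_
    calc _ ≤ ENNReal.ofReal A * volume Q := hap a l hl
      _ ≤ ENNReal.ofReal A * (2 * volume F) := by gcongr
      _ ≤ ENNReal.ofReal A * (2 * ((∫⁻ x in F, u x) ^ (1 / p) * (∫⁻ x in Q, v x) ^ (1 / q))) := by
          gcongr
          refine (volume_le_lintegral_rpow_mul hpq hu hv huv F).trans ?_
          gcongr
      _ = _ := by
          rw [ENNReal.ofReal_mul (by norm_num), ENNReal.ofReal_ofNat]
          ring
  have h2 : ∫⁻ x in Q, u x ≤ ENNReal.ofReal ((2 * A) ^ p) * ∫⁻ x in F, u x := by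
    have := ENNReal.rpow_le_rpow h1 hp.le
    rwa [ENNReal.mul_rpow_of_nonneg _ _ hp.le, ← ENNReal.rpow_mul, ← ENNReal.rpow_mul,
      one_div_mul_cancel hp.ne', ENNReal.rpow_one, ENNReal.rpow_one,
      ENNReal.ofReal_rpow_of_nonneg (by positivity) hp.le] at this
  have hQt := hut a l hl
  have hFt : ∫⁻ x in F, u x ≠ ∞ := ne_top_of_le_ne_top hQt (lintegral_mono_set hFQ)
  have hEt : ∫⁻ x in E, u x ≠ ∞ := ne_top_of_le_ne_top hQt (lintegral_mono_set hE)
  have hκ : 1 ≤ (2 * A) ^ p := Real.one_le_rpow (by linarith) hp.le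
  have hκ' : ((2 * A) ^ p)⁻¹ ≤ 1 := inv_le_one_of_one_le₀ hκ
  rw [← ENNReal.ofReal_toReal hQt, ← ENNReal.ofReal_toReal hFt,
    ← ENNReal.ofReal_mul (by positivity), ENNReal.ofReal_le_ofReal_iff (by positivity)] at h2
  rw [← ENNReal.ofReal_toReal hQt, ← ENNReal.ofReal_toReal hEt,
    ← ENNReal.ofReal_mul (by linarith)]
  refine ENNReal.ofReal_le_ofReal ?_
  have h3 := congrArg ENNReal.toReal hsplit
  rw [ENNReal.toReal_add hEt hFt] at h3
  have h4 : ((2 * A) ^ p)⁻¹ * (∫⁻ x in Q, u x).toReal ≤ (∫⁻ x in F, u x).toReal := by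
    rw [inv_mul_le_iff₀ (by linarith)]
    exact h2
  linarith

/-! ### Muckenhoupt weights -/

/-- The dual weight. -/
def dualWeight (p : ℝ) (w : (Fin n → ℝ) → ℝ) : (Fin n → ℝ) → ℝ :=
  fun x => w x ^ (1 - p / (p - 1))

theorem one_sub_div_sub_one {p : ℝ} (hp : 1 < p) : 1 - p / (p - 1) = -(1 / (p - 1)) := by
  have : p - 1 ≠ 0 := by linarith
  field_simp
  ring

theorem IsWeight.aemeasurable {w : (Fin n → ℝ) → ℝ} (hw : IsWeight w) : AEMeasurable w volume :=
  hw.1.aestronglyMeasurable.aemeasurable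

theorem IsWeight.aemeasurable_dualWeight {w : (Fin n → ℝ) → ℝ} (hw : IsWeight w) (p : ℝ) :
    AEMeasurable (dualWeight p w) volume :=
  hw.aemeasurable.pow_const _

theorem setLIntegral_cube_ofReal_ne_zero {w : (Fin n → ℝ) → ℝ} (hm : AEMeasurable w volume)
    (h : ∀ᵐ x, 0 < w x) (a : Fin n → ℝ) {l : ℝ} (hl : 0 < l) :
    ∫⁻ x in cube a l, ENNReal.ofReal (w x) ≠ 0 := by
  rw [Ne, lintegral_eq_zero_iff' hm.restrict.ennreal_ofReal]
  intro h0
  have h1 : ∀ᵐ _ ∂(volume.restrict (cube a l)), False := by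
    filter_upwards [h0, ae_restrict_of_ae h] with x hx hx'
    simp only [Pi.zero_apply, ENNReal.ofReal_eq_zero] at hx
    linarith
  rw [eventually_false_iff_eq_bot, ae_eq_bot, Measure.restrict_eq_zero] at h1
  exact volume_cube_ne_zero a hl h1

theorem IsWeight.ae_dual {w : (Fin n → ℝ) → ℝ} (hw : IsWeight w) {p : ℝ} (hp : 1 < p) :
    ∀ᵐ x, ENNReal.ofReal (w x) ^ (1 / p) *
      ENNReal.ofReal (dualWeight p w x) ^ (1 / (p / (p - 1))) = 1 := by
  filter_upwards [hw.2] with x hx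
  have h1 : p - 1 ≠ 0 := by linarith
  have h2 : p ≠ 0 := by linarith
  have hd : 0 < dualWeight p w x := Real.rpow_pos_of_pos hx _
  rw [ENNReal.ofReal_rpow_of_pos hx, ENNReal.ofReal_rpow_of_pos hd, dualWeight, ← Real.rpow_mul hx.le,
    ← ENNReal.ofReal_mul (by positivity), ← Real.rpow_add hx]
  have : 1 / p + (1 - p / (p - 1)) * (1 / (p / (p - 1))) = 0 := by
    field_simp
    ring
  rw [this, Real.rpow_zero, ENNReal.ofReal_one]

theorem IsWeight.setLIntegral_cube_ne_top {w : (Fin n → ℝ) → ℝ} (hw : IsWeight w)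
    (a : Fin n → ℝ) (l : ℝ) : ∫⁻ x in cube a l, ENNReal.ofReal (w x) ≠ ∞ := by
  have h := (hw.1.integrableOn_cube a l).2
  refine ne_top_of_le_ne_top h.ne (lintegral_mono fun x => ?_)
  exact Real.ofReal_le_enorm _

theorem apChar_cube_le {p : ℝ} {w : (Fin n → ℝ) → ℝ} {A : ℝ≥0∞} (h : apChar p w ≤ A)
    (a : Fin n → ℝ) {l : ℝ} (hl : 0 < l) :
    (⨍⁻ x in cube a l, ENNReal.ofReal (w x) ∂volume) *
      (⨍⁻ x in cube a l, ENNReal.ofReal (dualWeight p w x) ∂volume) ^ (p - 1) ≤ A :=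
  iSup_le_iff.1 (iSup_le_iff.1 (iSup_le_iff.1 h a) l) hl

theorem IsAp.setLIntegral_cube_dualWeight_ne_top {p : ℝ} (hp : 1 < p) {w : (Fin n → ℝ) → ℝ}
    (hw : IsAp p w) (a : Fin n → ℝ) {l : ℝ} (hl : 0 < l) :
    ∫⁻ x in cube a l, ENNReal.ofReal (dualWeight p w x) ≠ ∞ := by
  intro htop
  have h := apChar_cube_le (le_refl (apChar p w)) a hl
  rw [setLAverage_eq, setLAverage_eq, htop, ENNReal.top_div_of_ne_top (volume_cube_ne_top a l),
    ENNReal.top_rpow_of_pos (by linarith), ENNReal.mul_top] at h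
  · exact absurd hw.2 (not_lt.2 h)
  · exact (ENNReal.div_pos (setLIntegral_cube_ofReal_ne_zero hw.1.aemeasurable hw.1.2 a hl)
      (volume_cube_ne_top a l)).ne'

theorem IsWeight.dualWeight_pos {w : (Fin n → ℝ) → ℝ} (hw : IsWeight w) (p : ℝ) :
    ∀ᵐ x, 0 < dualWeight p w x := by
  filter_upwards [hw.2] with x hx
  exact Real.rpow_pos_of_pos hx _

theorem holderConjugate_div_sub_one {p : ℝ} (hp : 1 < p) : p.HolderConjugate (p / (p - 1)) :=
  Real.HolderConjugate.conjExponent hp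

/-- This is the `p`-th root of the `A_p` condition, which is symmetric in the weight and its dual.
Replacing `A` by `max 1 A` allows the exponent `1 / p` on the constant to be dropped. -/
theorem apChar_le_rpow {p : ℝ} (hp : 1 < p) {w : (Fin n → ℝ) → ℝ} {A : ℝ}
    (h : apChar p w ≤ ENNReal.ofReal A) (a : Fin n → ℝ) {l : ℝ} (hl : 0 < l) :
    (∫⁻ x in cube a l, ENNReal.ofReal (w x)) ^ (1 / p) *
      (∫⁻ x in cube a l, ENNReal.ofReal (dualWeight p w x)) ^ (1 / (p / (p - 1))) ≤
      ENNReal.ofReal (max 1 A) * volume (cube a l) := by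
  have hp0 : 0 < p := by linarith
  have hp1 : 0 < p - 1 := by linarith
  have h0 := volume_cube_ne_zero a hl
  have ht := volume_cube_ne_top a l
  have h1 := apChar_cube_le h a hl
  rw [setLAverage_eq, setLAverage_eq] at h1
  set U := ∫⁻ x in cube a l, ENNReal.ofReal (w x)
  set V := ∫⁻ x in cube a l, ENNReal.ofReal (dualWeight p w x)
  set Q := volume (cube a l)
  have e : 1 / (p / (p - 1)) = (p - 1) * (1 / p) := by field_simp
  have hpos : (0 : ℝ) ≤ 1 / p := by positivity
  calc U ^ (1 / p) * V ^ (1 / (p / (p - 1)))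
      = (U / Q * (V / Q) ^ (p - 1)) ^ (1 / p) * Q := by
        have hU : U = U / Q * Q := (ENNReal.div_mul_cancel h0 ht).symm
        have hV : V = V / Q * Q := (ENNReal.div_mul_cancel h0 ht).symm
        conv_lhs => rw [hU, hV]
        rw [e, ENNReal.rpow_mul, ← ENNReal.mul_rpow_of_nonneg _ _ hpos,
          ENNReal.mul_rpow_of_nonneg _ _ hp1.le,
          mul_mul_mul_comm, ENNReal.mul_rpow_of_nonneg _ _ hpos]
        congr 1
        nth_rewrite 1 [← ENNReal.rpow_one Q]
        rw [← ENNReal.rpow_add _ _ h0 ht, ← ENNReal.rpow_mul]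
        have : (1 + (p - 1)) * (1 / p) = 1 := by field_simp; ring
        rw [this, ENNReal.rpow_one]
    _ ≤ (ENNReal.ofReal (max 1 A)) ^ (1 / p) * Q := by
        gcongr
        exact h1.trans (ENNReal.ofReal_le_ofReal (le_max_right _ _))
    _ ≤ ENNReal.ofReal (max 1 A) * Q := by
        gcongr
        have h1A : 1 ≤ ENNReal.ofReal (max 1 A) := by
          rw [ENNReal.one_le_ofReal]; exact le_max_left _ _
        calc _ ≤ ENNReal.ofReal (max 1 A) ^ (1 : ℝ) :=
              ENNReal.rpow_le_rpow_of_exponent_le h1A (by rw [div_le_one hp0]; linarith)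
          _ = _ := ENNReal.rpow_one _

/-- Hölder on a single unit cube. Needed because `F` is only known to be monotone on `[1, ∞)`. -/
theorem one_le_apChar {p : ℝ} (hp : 1 < p) {w : (Fin n → ℝ) → ℝ} (hw : IsAp p w) :
    1 ≤ apChar p w := by
  have hp0 : 0 < p := by linarith
  have h := volume_le_lintegral_rpow_mul (holderConjugate_div_sub_one hp)
    hw.1.aemeasurable.ennreal_ofReal (hw.1.aemeasurable_dualWeight p).ennreal_ofReal
    (hw.1.ae_dual hp) (cube (n := n) 0 1)
  have h1 := apChar_cube_le (le_refl (apChar p w)) 0 one_pos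
  have hv : volume (cube (n := n) 0 1) = 1 := by rw [volume_cube]; simp
  rw [setLAverage_eq, setLAverage_eq, hv, div_one, div_one] at h1
  rw [hv] at h
  refine le_trans ?_ h1
  have h2 := ENNReal.rpow_le_rpow h hp0.le
  rw [ENNReal.one_rpow, ENNReal.mul_rpow_of_nonneg _ _ hp0.le, ← ENNReal.rpow_mul,
    ← ENNReal.rpow_mul, one_div_mul_cancel hp0.ne', ENNReal.rpow_one] at h2
  have e : 1 / (p / (p - 1)) * p = p - 1 := by
    have : p - 1 ≠ 0 := by linarith
    field_simp
  rwa [e] at h2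

/-- The logarithm of a Muckenhoupt weight is locally integrable. -/
theorem IsAp.locallyIntegrable_log {p : ℝ} (hp : 1 < p) {w : (Fin n → ℝ) → ℝ} (hw : IsAp p w) :
    LocallyIntegrable (fun x => Real.log (w x)) volume := by
  have hp1 : 0 < p - 1 := by linarith
  refine locallyIntegrable_of_lintegral_cube hw.1.aemeasurable.log.aestronglyMeasurable
    fun a l hl => ?_
  -- The inequality `log t ≤ t - 1` at `w` bounds the logarithm above; at the dual weight, whose
  -- logarithm is `-log w / (p - 1)`, it bounds it below.
  have hle : ∫⁻ x in cube a l, ‖Real.log (w x)‖ₑ ≤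
      ∫⁻ x in cube a l, (ENNReal.ofReal (w x) +
        ENNReal.ofReal (p - 1) * ENNReal.ofReal (dualWeight p w x)) := by
    refine lintegral_mono_ae (ae_restrict_of_ae ?_)
    filter_upwards [hw.1.2] with x hx
    have hd : 0 < dualWeight p w x := Real.rpow_pos_of_pos hx _
    rw [← ENNReal.ofReal_mul hp1.le, ← ENNReal.ofReal_add hx.le (by positivity),
      Real.enorm_eq_ofReal_abs]
    refine ENNReal.ofReal_le_ofReal (abs_le.2 ⟨?_, ?_⟩)
    · have h1 := Real.log_le_sub_one_of_pos hd
      rw [dualWeight, Real.log_rpow hx, one_sub_div_sub_one hp] at h1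
      have h2 := mul_le_mul_of_nonneg_left h1 hp1.le
      have h3 : (p - 1) * (-(1 / (p - 1)) * Real.log (w x)) = -Real.log (w x) := by
        field_simp
      rw [h3] at h2
      have h4 : w x ^ (-(1 / (p - 1))) = dualWeight p w x := by
        rw [dualWeight, one_sub_div_sub_one hp]
      rw [h4] at h2
      linarith
    · have h1 := Real.log_le_sub_one_of_pos hx
      have : 0 < (p - 1) * dualWeight p w x := by positivity
      linarith
  refine hle.trans_lt ?_
  rw [lintegral_add_left' hw.1.aemeasurable.ennreal_ofReal.restrict,
    lintegral_const_mul' _ _ ENNReal.ofReal_ne_top]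
  exact ENNReal.add_lt_top.2 ⟨(hw.1.setLIntegral_cube_ne_top a l).lt_top,
    ENNReal.mul_lt_top ENNReal.ofReal_lt_top
      (hw.setLIntegral_cube_dualWeight_ne_top hp a hl).lt_top⟩

theorem bmoNorm_const_mul_le (k : ℝ) (g : (Fin n → ℝ) → ℝ) :
    bmoNorm (fun x => k * g x) ≤ ENNReal.ofReal |k| * bmoNorm g := by
  refine iSup_le fun a => iSup_le fun l => iSup_le fun hl => ?_
  have h1 : (⨍⁻ x in cube a l, ‖g x - ⨍ y in cube a l, g y ∂volume‖ₑ ∂volume) ≤ bmoNorm g :=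
    iSup_le_iff.1 (iSup_le_iff.1 (iSup_le_iff.1 (le_refl (bmoNorm g)) a) l) hl
  refine le_trans (le_of_eq ?_) (mul_le_mul_right h1 _)
  rw [setLAverage_eq, setLAverage_eq, ← mul_div_assoc, ← lintegral_const_mul' _ _ ENNReal.ofReal_ne_top]
  congr 1
  refine lintegral_congr fun x => ?_
  rw [← Real.enorm_eq_ofReal_abs, ← enorm_mul, mul_sub]
  congr 2
  rw [setAverage_eq, setAverage_eq, integral_const_mul, smul_eq_mul, smul_eq_mul]
  ring

theorem cubeAvg_const_mul (k : ℝ) (g : (Fin n → ℝ) → ℝ) (a : Fin n → ℝ) (l : ℝ) :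
    cubeAvg (fun x => k * g x) a l = k * cubeAvg g a l := by
  rw [cubeAvg, cubeAvg, setAverage_eq, setAverage_eq, integral_const_mul, smul_eq_mul, smul_eq_mul]
  ring

theorem setLIntegral_mul_exp_le {u g : (Fin n → ℝ) → ℝ} (hu : AEMeasurable u volume)
    (hg : AEMeasurable g volume) {C : ℝ} {a : Fin n → ℝ} {l : ℝ}
    (h : ∫⁻ x in cube a l, ENNReal.ofReal (Real.exp |g x - cubeAvg g a l|)
        ∂(volume.withDensity fun x => ENNReal.ofReal (u x)) ≤
      ENNReal.ofReal C * volume.withDensity (fun x => ENNReal.ofReal (u x)) (cube a l)) :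
    ∫⁻ x in cube a l, ENNReal.ofReal (u x) * ENNReal.ofReal (Real.exp (g x)) ≤
      ENNReal.ofReal (Real.exp (cubeAvg g a l)) *
        (ENNReal.ofReal C * ∫⁻ x in cube a l, ENNReal.ofReal (u x)) := by
  have hmeas : Measurable fun y : ℝ => ENNReal.ofReal (Real.exp |y - cubeAvg g a l|) := by
    fun_prop
  have hfm : AEMeasurable (fun x => ENNReal.ofReal (Real.exp |g x - cubeAvg g a l|))
      (volume.restrict (cube a l)) := hmeas.comp_aemeasurable hg.restrict
  rw [withDensity_apply _ (measurableSet_cube a l), restrict_withDensity (measurableSet_cube a l),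
    lintegral_withDensity_eq_lintegral_mul₀ hu.restrict.ennreal_ofReal
      hfm] at h
  refine le_trans ?_ (mul_le_mul_right h _)
  rw [← lintegral_const_mul' _ _ ENNReal.ofReal_ne_top]
  refine lintegral_mono fun x => ?_
  rw [Pi.mul_apply, mul_left_comm]
  gcongr
  rw [← ENNReal.ofReal_mul (Real.exp_pos _).le, ← Real.exp_add]
  refine ENNReal.ofReal_le_ofReal (Real.exp_le_exp.2 ?_)
  linarith [le_abs_self (g x - cubeAvg g a l)]

/-- Multiplication by the exponential of a function of small `BMO` norm preserves `A_p`, with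
control of the characteristic. -/
theorem exists_isAp_mul_exp (n : ℕ) {p : ℝ} (hp : 1 < p) (A : ℝ) :
    ∃ ε : ℝ, 0 < ε ∧ ∃ B : ℝ, ∀ w : (Fin n → ℝ) → ℝ, IsAp p w →
      apChar p w ≤ ENNReal.ofReal A → ∀ g : (Fin n → ℝ) → ℝ, LocallyIntegrable g volume →
      bmoNorm g ≤ ENNReal.ofReal ε →
      IsAp p (fun x => w x * Real.exp (g x)) ∧
        apChar p (fun x => w x * Real.exp (g x)) ≤ ENNReal.ofReal B := by
  have hp0 : 0 < p := by linarith
  have hp1 : 0 < p - 1 := by linarith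
  set q := p / (p - 1) with hq
  have hpq : p.HolderConjugate q := holderConjugate_div_sub_one hp
  set M := max 1 A with hM
  have hM1 : 1 ≤ M := le_max_left _ _
  have hβ : ∀ r : ℝ, 0 < r → 0 ≤ 1 - ((2 * M) ^ r)⁻¹ ∧ 1 - ((2 * M) ^ r)⁻¹ < 1 := by
    intro r hr
    have h1 : 1 ≤ (2 * M) ^ r := Real.one_le_rpow (by linarith) hr.le
    have h2 : ((2 * M) ^ r)⁻¹ ≤ 1 := inv_le_one_of_one_le₀ h1
    have h3 : 0 < ((2 * M) ^ r)⁻¹ := by positivity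
    constructor <;> linarith
  obtain ⟨ε₁, hε₁, C₁, hC₁, hJ₁⟩ := exists_john_nirenberg_const n (hβ p hp0).1 (hβ p hp0).2
  obtain ⟨ε₂, hε₂, C₂, hC₂, hJ₂⟩ := exists_john_nirenberg_const n
    (hβ q hpq.symm.pos).1 (hβ q hpq.symm.pos).2
  -- The dual of `w exp g` is the dual of `w` times `exp (-g / (p - 1))`, so the second smallness
  -- condition is rescaled by `p - 1`.
  refine ⟨min ε₁ ((p - 1) * ε₂), by positivity, C₁ * C₂ ^ (p - 1) * M, ?_⟩
  intro w hw hA g hg hb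
  have hwm := hw.1.aemeasurable
  have hdm := hw.1.aemeasurable_dualWeight p
  have hgm := hg.aestronglyMeasurable.aemeasurable
  have hU := halfProportion_of_dual hpq hwm.ennreal_ofReal hdm.ennreal_ofReal (hw.1.ae_dual hp) hM1
    (fun a l _ => hw.1.setLIntegral_cube_ne_top a l)
    (fun a l hl => setLIntegral_cube_ofReal_ne_zero hdm (hw.1.dualWeight_pos p) a hl)
    (fun a l hl => hw.setLIntegral_cube_dualWeight_ne_top hp a hl)
    (fun a l hl => apChar_le_rpow hp hA a hl)
  have hV := halfProportion_of_dual hpq.symm hdm.ennreal_ofReal hwm.ennreal_ofReal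
    ((hw.1.ae_dual hp).mono fun x hx => by rwa [mul_comm]) hM1
    (fun a l hl => hw.setLIntegral_cube_dualWeight_ne_top hp a hl)
    (fun a l hl => setLIntegral_cube_ofReal_ne_zero hwm hw.1.2 a hl)
    (fun a l _ => hw.1.setLIntegral_cube_ne_top a l)
    (fun a l hl => by rw [mul_comm]; exact apChar_le_rpow hp hA a hl)
  set h : (Fin n → ℝ) → ℝ := fun x => -(1 / (p - 1)) * g x with hh
  have hhb : bmoNorm h ≤ ENNReal.ofReal ε₂ := by
    refine (bmoNorm_const_mul_le _ g).trans ((mul_le_mul_right hb _).trans ?_)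
    rw [abs_neg, abs_of_pos (by positivity), ← ENNReal.ofReal_mul (by positivity)]
    refine ENNReal.ofReal_le_ofReal ?_
    rw [one_div, inv_mul_le_iff₀ hp1]
    exact min_le_right _ _
  have hhm : AEMeasurable h volume := hgm.const_mul _
  have hhl : LocallyIntegrable h volume := hg.smul (-(1 / (p - 1)))
  have key₁ : ∀ (a : Fin n → ℝ) (l : ℝ), 0 < l → _ := fun a l hl =>
    setLIntegral_mul_exp_le hwm hgm (hJ₁ _ (withDensity_absolutelyContinuous _ _) hU g hg
      (hb.trans (ENNReal.ofReal_le_ofReal (min_le_left _ _))) a l hl)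
  have key₂ : ∀ (a : Fin n → ℝ) (l : ℝ), 0 < l → _ := fun a l hl =>
    setLIntegral_mul_exp_le hdm hhm (hJ₂ _ (withDensity_absolutelyContinuous _ _) hV h hhl hhb
      a l hl)
  have e₁ : ∀ x, ENNReal.ofReal (w x * Real.exp (g x)) =
      ENNReal.ofReal (w x) * ENNReal.ofReal (Real.exp (g x)) := fun x =>
    ENNReal.ofReal_mul' (Real.exp_pos _).le
  have e₂ : ∀ᵐ x, ENNReal.ofReal ((w x * Real.exp (g x)) ^ (1 - p / (p - 1))) =
      ENNReal.ofReal (dualWeight p w x) * ENNReal.ofReal (Real.exp (h x)) := by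
    filter_upwards [hw.1.2] with x hx
    rw [Real.mul_rpow hx.le (Real.exp_pos _).le, ENNReal.ofReal_mul' (by positivity),
      ← Real.exp_mul, one_sub_div_sub_one hp, mul_comm (g x), dualWeight, one_sub_div_sub_one hp]
  have hchar : apChar p (fun x => w x * Real.exp (g x)) ≤
      ENNReal.ofReal (C₁ * C₂ ^ (p - 1) * M) := by
    refine iSup_le fun a => iSup_le fun l => iSup_le fun hl => ?_
    have k₁ := key₁ a l hl
    have k₂ := key₂ a l hl
    have kA := apChar_cube_le (hA.trans (ENNReal.ofReal_le_ofReal (le_max_right 1 A))) a hl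
    rw [setLAverage_eq, setLAverage_eq, lintegral_congr_ae (ae_restrict_of_ae e₂)]
    simp_rw [e₁]
    rw [setLAverage_eq, setLAverage_eq] at kA
    rw [cubeAvg_const_mul] at k₂
    set U := ∫⁻ x in cube a l, ENNReal.ofReal (w x)
    set V := ∫⁻ x in cube a l, ENNReal.ofReal (dualWeight p w x)
    set Q := volume (cube a l)
    set m := cubeAvg g a l
    calc _ ≤ (ENNReal.ofReal (Real.exp m) * (ENNReal.ofReal C₁ * U) / Q) *
          (ENNReal.ofReal (Real.exp (-(1 / (p - 1)) * m)) * (ENNReal.ofReal C₂ * V) / Q) ^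
            (p - 1) := by gcongr
      _ = (ENNReal.ofReal (Real.exp m) *
            ENNReal.ofReal (Real.exp (-(1 / (p - 1)) * m)) ^ (p - 1)) *
          (ENNReal.ofReal C₁ * ENNReal.ofReal C₂ ^ (p - 1)) * (U / Q * (V / Q) ^ (p - 1)) := by
          rw [mul_div_assoc, mul_div_assoc, mul_div_assoc, mul_div_assoc,
            ENNReal.mul_rpow_of_nonneg _ _ hp1.le, ENNReal.mul_rpow_of_nonneg _ _ hp1.le]
          ring
      -- The average `m` of `g` may be arbitrarily large, but its two exponential factors cancel
      -- exactly.
      _ = (ENNReal.ofReal C₁ * ENNReal.ofReal C₂ ^ (p - 1)) * (U / Q * (V / Q) ^ (p - 1)) := by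
          rw [ENNReal.ofReal_rpow_of_pos (Real.exp_pos _), ← Real.exp_mul,
            ← ENNReal.ofReal_mul (Real.exp_pos _).le, ← Real.exp_add]
          have : m + -(1 / (p - 1)) * m * (p - 1) = 0 := by field_simp; ring
          rw [this, Real.exp_zero, ENNReal.ofReal_one, one_mul]
      _ ≤ (ENNReal.ofReal C₁ * ENNReal.ofReal C₂ ^ (p - 1)) * ENNReal.ofReal M := by gcongr
      _ = _ := by
          rw [ENNReal.ofReal_rpow_of_pos hC₂, ENNReal.ofReal_mul (by positivity),
            ENNReal.ofReal_mul hC₁.le]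
  refine ⟨⟨⟨?_, ?_⟩, hchar.trans_lt ENNReal.ofReal_lt_top⟩, hchar⟩
  · refine locallyIntegrable_of_lintegral_cube
      (hwm.mul hgm.exp).aestronglyMeasurable fun a l hl => ?_
    have : ∫⁻ x in cube a l, ‖w x * Real.exp (g x)‖ₑ =
        ∫⁻ x in cube a l, ENNReal.ofReal (w x) * ENNReal.ofReal (Real.exp (g x)) := by
      refine lintegral_congr_ae (ae_restrict_of_ae ?_)
      filter_upwards [hw.1.2] with x hx
      rw [← e₁, Real.enorm_eq_ofReal (by positivity)]
    rw [this]
    refine (key₁ a l hl).trans_lt ?_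
    exact ENNReal.mul_lt_top ENNReal.ofReal_lt_top (ENNReal.mul_lt_top ENNReal.ofReal_lt_top
      (hw.1.setLIntegral_cube_ne_top a l).lt_top)
  · filter_upwards [hw.1.2] with x hx
    positivity

/-! ### The `K`-functional of a pair of weighted spaces -/

/-- The coefficient of the optimal splitting of `f` for the functional
`‖f₀‖ ^ p + exp s * ‖f₁‖ ^ p`. -/
def splitCoeff (p s : ℝ) : ℝ := Real.sigmoid (s / (p - 1))

/-- The value of the functional at the optimal splitting of `1`. -/
def splitCost (p s : ℝ) : ℝ := splitCoeff p s ^ (p - 1)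

theorem splitCoeff_pos (p s : ℝ) : 0 < splitCoeff p s := Real.sigmoid_pos _

theorem splitCoeff_lt_one (p s : ℝ) : splitCoeff p s < 1 := Real.sigmoid_lt_one _

theorem splitCost_pos (p s : ℝ) : 0 < splitCost p s := Real.rpow_pos_of_pos (splitCoeff_pos p s) _

theorem continuous_splitCoeff (p : ℝ) : Continuous (splitCoeff p) := by
  have h : Continuous Real.sigmoid := continuous_iff_continuousAt.2 fun x =>
    (Real.hasDerivAt_sigmoid x).continuousAt
  exact h.comp (continuous_id.div_const _)

theorem continuous_splitCost (p : ℝ) : Continuous (splitCost p) :=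
  (continuous_splitCoeff p).rpow_const fun s => Or.inl (splitCoeff_pos p s).ne'

/-- The critical point equation of `α ↦ α^p + e^s (1 - α)^p`; it is what dictates the sigmoid. -/
theorem one_sub_splitCoeff_rpow {p : ℝ} (hp : 1 < p) (s : ℝ) :
    Real.exp s * (1 - splitCoeff p s) ^ (p - 1) = splitCost p s := by
  have hp1 : p - 1 ≠ 0 := by linarith
  rw [splitCost, splitCoeff, ← Real.sigmoid_neg, ← Real.sigmoid_mul_rexp_neg,
    Real.mul_rpow (Real.sigmoid_nonneg _) (Real.exp_pos _).le, ← Real.exp_mul, mul_left_comm,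
    ← Real.exp_add]
  have : s + -(s / (p - 1)) * (p - 1) = 0 := by field_simp; ring
  rw [this, Real.exp_zero, mul_one]

theorem splitCoeff_rpow_add {p : ℝ} (hp : 1 < p) (s : ℝ) :
    splitCoeff p s ^ p + Real.exp s * (1 - splitCoeff p s) ^ p = splitCost p s := by
  have ha := splitCoeff_pos p s
  have hb : 0 < 1 - splitCoeff p s := sub_pos.2 (splitCoeff_lt_one p s)
  have h := one_sub_splitCoeff_rpow hp s
  have e : ∀ t : ℝ, 0 < t → t ^ p = t ^ (p - 1) * t := fun t ht => by
    rw [← Real.rpow_add_one ht.ne', sub_add_cancel]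
  rw [e _ ha, e _ hb, ← mul_assoc, h, splitCost]
  ring

/-- Convexity of `t ↦ t^p` at `x / a` and `y / b` with weights `a` and `b = 1 - a`, where `a` is the
optimal coefficient. With `splitCoeff_rpow_add` this shows that `splitCost` is the exact minimum. -/
theorem splitCost_mul_add_rpow_le {p : ℝ} (hp : 1 < p) (s : ℝ) {x y : ℝ} (hx : 0 ≤ x)
    (hy : 0 ≤ y) : splitCost p s * (x + y) ^ p ≤ x ^ p + Real.exp s * y ^ p := by
  have ha := splitCoeff_pos p s
  have hb : 0 < 1 - splitCoeff p s := sub_pos.2 (splitCoeff_lt_one p s)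
  have h := one_sub_splitCoeff_rpow hp s
  have hψ : splitCost p s = splitCoeff p s ^ (p - 1) := rfl
  have hψ0 := splitCost_pos p s
  set a := splitCoeff p s
  set b := 1 - a with hbdef
  have e : ∀ t z : ℝ, 0 < t → 0 ≤ z → t * (z / t) ^ p * t ^ (p - 1) = z ^ p := fun t z ht hz => by
    have h1 : t ^ p = t ^ (p - 1) * t := by rw [← Real.rpow_add_one ht.ne', sub_add_cancel]
    have h2 : 0 < t ^ (p - 1) := Real.rpow_pos_of_pos ht _
    rw [Real.div_rpow hz ht.le, h1]
    field_simp
  have hc := (convexOn_rpow hp.le).2 (x := x / a) (y := y / b) (by simp only [Set.mem_Ici]; positivity)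
    (by simp only [Set.mem_Ici]; positivity) ha.le hb.le (by rw [hbdef]; ring)
  simp only [smul_eq_mul] at hc
  rw [mul_div_cancel₀ _ ha.ne', mul_div_cancel₀ _ hb.ne'] at hc
  calc splitCost p s * (x + y) ^ p
      ≤ splitCost p s * (a * (x / a) ^ p + b * (y / b) ^ p) := by gcongr
    _ = a * (x / a) ^ p * a ^ (p - 1) + Real.exp s * (b * (y / b) ^ p * b ^ (p - 1)) := by
        rw [mul_add]
        congr 1
        · rw [hψ]; ring
        · rw [← h]; ring
    _ = x ^ p + Real.exp s * y ^ p := by rw [e a x ha hx, e b y hb hy]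

/-- The cost is at most `min 1 (e^s)`, as the trivial splittings show. -/
theorem splitCost_le_exp_mul {p : ℝ} (hp : 1 < p) {θ : ℝ} (h0 : 0 ≤ θ) (h1 : θ ≤ 1) (s : ℝ) :
    splitCost p s ≤ Real.exp (θ * s) := by
  have hp1 : 0 < p - 1 := by linarith
  have ha := splitCoeff_pos p s
  rcases le_total 0 s with hs | hs
  · calc splitCost p s ≤ 1 := Real.rpow_le_one ha.le (splitCoeff_lt_one p s).le hp1.le
      _ ≤ _ := Real.one_le_exp (by positivity)
  · calc splitCost p s = Real.exp s * (1 - splitCoeff p s) ^ (p - 1) :=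
          (one_sub_splitCoeff_rpow hp s).symm
      _ ≤ Real.exp s * 1 := by
          gcongr
          exact Real.rpow_le_one (sub_nonneg.2 (splitCoeff_lt_one p s).le) (by linarith) hp1.le
      _ ≤ _ := by
          rw [mul_one]
          exact Real.exp_le_exp.2 (by nlinarith)

/-- The normalizing constant of the real interpolation method. -/
def interpConst (p θ : ℝ) : ℝ≥0∞ :=
  ∫⁻ s : ℝ, ENNReal.ofReal (Real.exp (-(θ * s))) * ENNReal.ofReal (splitCost p s)

theorem measurable_ofReal_splitCost (p : ℝ) :
    Measurable fun s => ENNReal.ofReal (splitCost p s) :=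
  (continuous_splitCost p).measurable.ennreal_ofReal

theorem measurable_ofReal_exp_neg_mul (θ : ℝ) :
    Measurable fun s : ℝ => ENNReal.ofReal (Real.exp (-(θ * s))) := by fun_prop

theorem interpConst_ne_zero (p θ : ℝ) : interpConst p θ ≠ 0 := by
  have hm : Measurable fun s : ℝ =>
      ENNReal.ofReal (Real.exp (-(θ * s))) * ENNReal.ofReal (splitCost p s) :=
    (measurable_ofReal_exp_neg_mul θ).mul (measurable_ofReal_splitCost p)
  rw [interpConst, Ne, lintegral_eq_zero_iff hm]
  intro h
  obtain ⟨s, hs⟩ := h.exists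
  simp only [Pi.zero_apply, mul_eq_zero, ENNReal.ofReal_eq_zero] at hs
  rcases hs with hs | hs
  · exact absurd (Real.exp_pos _) (not_lt.2 hs)
  · exact absurd (splitCost_pos p s) (not_lt.2 hs)

theorem interpConst_ne_top {p : ℝ} (hp : 1 < p) {θ : ℝ} (h0 : 0 < θ) (h1 : θ < 1) :
    interpConst p θ ≠ ∞ := by
  have hle : ∀ η, 0 ≤ η → η ≤ 1 → ∀ s : ℝ,
      ENNReal.ofReal (Real.exp (-(θ * s))) * ENNReal.ofReal (splitCost p s) ≤
        ENNReal.ofReal (Real.exp ((η - θ) * s)) := fun η hη hη' s => by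
    rw [← ENNReal.ofReal_mul (Real.exp_pos _).le]
    refine ENNReal.ofReal_le_ofReal ?_
    calc _ ≤ Real.exp (-(θ * s)) * Real.exp (η * s) := by
          gcongr; exact splitCost_le_exp_mul hp hη hη' s
      _ = _ := by rw [← Real.exp_add]; congr 1; ring
  have hfin : ∀ (S : Set ℝ) (r : ℝ), IntegrableOn (fun x => Real.exp (r * x)) S volume →
      ∫⁻ s in S, ENNReal.ofReal (Real.exp (r * s)) < ∞ := fun S r h => by
    refine lt_of_le_of_lt (lintegral_mono fun s => ?_) h.2
    exact Real.ofReal_le_enorm _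
  rw [interpConst, ← lintegral_add_compl _ (measurableSet_Iic (a := (0 : ℝ))), Set.compl_Iic]
  refine (ENNReal.add_lt_top.2 ⟨?_, ?_⟩).ne
  -- The bound `e^s` is used on the negative half-line, the bound `1` on the positive one.
  · exact lt_of_le_of_lt (lintegral_mono fun s => hle 1 zero_le_one le_rfl s)
      (hfin _ _ (integrableOn_exp_mul_Iic (by linarith) 0))
  · exact lt_of_le_of_lt (lintegral_mono fun s => hle 0 le_rfl zero_le_one s)
      (hfin _ _ (integrableOn_exp_mul_Ioi (by linarith) 0))

/-- Translation invariance in `s`: a shift by `r`, the logarithm of a density, comes out as the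
density to the power `θ`. -/
theorem lintegral_exp_mul_splitCost_add (p θ r : ℝ) :
    ∫⁻ s : ℝ, ENNReal.ofReal (Real.exp (-(θ * s))) * ENNReal.ofReal (splitCost p (s + r)) =
      interpConst p θ * ENNReal.ofReal (Real.exp (θ * r)) := by
  rw [interpConst, ← lintegral_add_right_eq_self (fun s : ℝ =>
    ENNReal.ofReal (Real.exp (-(θ * s))) * ENNReal.ofReal (splitCost p s)) r, mul_comm,
    ← lintegral_const_mul' _ _ ENNReal.ofReal_ne_top]
  refine lintegral_congr fun s => ?_
  rw [← mul_assoc, ← ENNReal.ofReal_mul (p := Real.exp (θ * r)) (Real.exp_pos _).le, ← Real.exp_add]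
  congr 3
  ring

theorem lintegral_exp_mul_lintegral_splitCost {p θ : ℝ} {F : (Fin n → ℝ) → ℝ≥0∞}
    {ρ : (Fin n → ℝ) → ℝ} (hF : AEMeasurable F volume) (hρ : AEMeasurable ρ volume) :
    ∫⁻ s : ℝ, ENNReal.ofReal (Real.exp (-(θ * s))) *
        ∫⁻ x, F x * ENNReal.ofReal (splitCost p (s + ρ x)) =
      interpConst p θ * ∫⁻ x, F x * ENNReal.ofReal (Real.exp (θ * ρ x)) := by
  have hmeas : AEMeasurable (Function.uncurry fun (s : ℝ) (x : Fin n → ℝ) =>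
      ENNReal.ofReal (Real.exp (-(θ * s))) * (F x * ENNReal.ofReal (splitCost p (s + ρ x))))
      ((volume : Measure ℝ).prod (volume : Measure (Fin n → ℝ))) := by
    refine ((measurable_ofReal_exp_neg_mul θ).comp measurable_fst).aemeasurable.mul
      (hF.comp_snd.mul ?_)
    exact (measurable_ofReal_splitCost p).comp_aemeasurable
      (measurable_fst.aemeasurable.add hρ.comp_snd)
  have hswap := lintegral_lintegral_swap hmeas
  calc _ = ∫⁻ s : ℝ, ∫⁻ x, ENNReal.ofReal (Real.exp (-(θ * s))) *
        (F x * ENNReal.ofReal (splitCost p (s + ρ x))) := by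
        refine lintegral_congr fun s => ?_
        rw [lintegral_const_mul' _ _ ENNReal.ofReal_ne_top]
    _ = ∫⁻ x, ∫⁻ s : ℝ, ENNReal.ofReal (Real.exp (-(θ * s))) *
        (F x * ENNReal.ofReal (splitCost p (s + ρ x))) := hswap
    _ = ∫⁻ x, interpConst p θ * (F x * ENNReal.ofReal (Real.exp (θ * ρ x))) := by
        refine lintegral_congr fun x => ?_
        rw [mul_left_comm, ← lintegral_exp_mul_splitCost_add, ← lintegral_const_mul]
        · exact lintegral_congr fun s => mul_left_comm _ _ _
        · exact (measurable_ofReal_exp_neg_mul θ).mul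
            ((measurable_ofReal_splitCost p).comp (measurable_id.add_const _))
    _ = _ := by
        refine lintegral_const_mul'' _ (hF.mul ?_)
        exact (hρ.const_mul θ).exp.ennreal_ofReal

/-- An inequality between `K`-functionals integrates to a weighted inequality. -/
theorem lintegral_mul_exp_le_of_splitCost {p : ℝ} (hp : 1 < p) {θ : ℝ} (h0 : 0 < θ) (h1 : θ < 1)
    {F H : (Fin n → ℝ) → ℝ≥0∞} {ρ : (Fin n → ℝ) → ℝ} (hF : AEMeasurable F volume)
    (hH : AEMeasurable H volume) (hρ : AEMeasurable ρ volume) {K κ : ℝ} (hK : 0 ≤ K)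
    (h : ∀ s : ℝ, ∫⁻ x, H x * ENNReal.ofReal (splitCost p (s + ρ x)) ≤
      ENNReal.ofReal K * ∫⁻ x, F x * ENNReal.ofReal (splitCost p (s + (κ + ρ x)))) :
    ∫⁻ x, H x * ENNReal.ofReal (Real.exp (θ * ρ x)) ≤
      ENNReal.ofReal (K * Real.exp (θ * κ)) *
        ∫⁻ x, F x * ENNReal.ofReal (Real.exp (θ * ρ x)) := by
  refine (ENNReal.mul_le_mul_iff_right (interpConst_ne_zero p θ)
    (interpConst_ne_top hp h0 h1)).1 ?_
  rw [← lintegral_exp_mul_lintegral_splitCost hH hρ]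
  calc _ ≤ ∫⁻ s : ℝ, ENNReal.ofReal K * (ENNReal.ofReal (Real.exp (-(θ * s))) *
        ∫⁻ x, F x * ENNReal.ofReal (splitCost p (s + (κ + ρ x)))) := by
        refine lintegral_mono fun s => ?_
        rw [mul_left_comm]
        exact mul_le_mul_right (h s) _
    _ = ENNReal.ofReal K * (interpConst p θ *
        ∫⁻ x, F x * ENNReal.ofReal (Real.exp (θ * (κ + ρ x)))) := by
        rw [lintegral_const_mul' _ _ ENNReal.ofReal_ne_top,
          lintegral_exp_mul_lintegral_splitCost hF (hρ.const_add κ)]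
    _ = _ := by
        have : ∫⁻ x, F x * ENNReal.ofReal (Real.exp (θ * (κ + ρ x))) =
            ENNReal.ofReal (Real.exp (θ * κ)) *
              ∫⁻ x, F x * ENNReal.ofReal (Real.exp (θ * ρ x)) := by
          rw [← lintegral_const_mul' _ _ ENNReal.ofReal_ne_top]
          refine lintegral_congr fun x => ?_
          rw [mul_left_comm, ← ENNReal.ofReal_mul (Real.exp_pos _).le, ← Real.exp_add, mul_add]
        rw [this, ENNReal.ofReal_mul hK]
        ring

/-! ### Weighted norms and operators -/

variable {𝕜 : Type*} [RCLike 𝕜]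

theorem aemeasurable_enorm_rpow_mul (p : ℝ) {w : (Fin n → ℝ) → ℝ} (hw : AEMeasurable w volume)
    (f : (Fin n → ℝ) →ₘ[volume] 𝕜) :
    AEMeasurable (fun x => ‖f x‖ₑ ^ p * ENNReal.ofReal (w x)) volume :=
  (f.aestronglyMeasurable.enorm.pow_const p).mul hw.ennreal_ofReal

theorem eLpNorm_wMeasure_rpow {p : ℝ} (hp : 1 < p) {w : (Fin n → ℝ) → ℝ}
    (hw : AEMeasurable w volume) (f : (Fin n → ℝ) →ₘ[volume] 𝕜) :
    eLpNorm f (ENNReal.ofReal p) (wMeasure w) ^ p =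
      ∫⁻ x, ‖f x‖ₑ ^ p * ENNReal.ofReal (w x) := by
  have hp0 : 0 < p := by linarith
  rw [eLpNorm_eq_lintegral_rpow_enorm_toReal (by simpa using hp0) ENNReal.ofReal_ne_top,
    ENNReal.toReal_ofReal hp0.le, ← ENNReal.rpow_mul, one_div_mul_cancel hp0.ne',
    ENNReal.rpow_one, wMeasure, lintegral_withDensity_eq_lintegral_mul₀ hw.ennreal_ofReal
      (f.aestronglyMeasurable.enorm.pow_const p)]
  exact lintegral_congr fun x => mul_comm _ _

theorem memLp_wMeasure {p : ℝ} (hp : 1 < p) {w : (Fin n → ℝ) → ℝ}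
    (hw : AEMeasurable w volume) {f : (Fin n → ℝ) →ₘ[volume] 𝕜}
    (h : ∫⁻ x, ‖f x‖ₑ ^ p * ENNReal.ofReal (w x) ≠ ∞) :
    MemLp f (ENNReal.ofReal p) (wMeasure w) := by
  refine ⟨f.aestronglyMeasurable.mono_ac (withDensity_absolutelyContinuous _ _), ?_⟩
  rw [← eLpNorm_wMeasure_rpow hp hw] at h
  by_contra htop
  rw [not_lt, top_le_iff] at htop
  rw [htop, ENNReal.top_rpow_of_pos (by linarith)] at h
  exact h rfl

variable {D : Submodule 𝕜 ((Fin n → ℝ) →ₘ[volume] 𝕜)}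
  {T : D → ((Fin n → ℝ) →ₘ[volume] 𝕜)}

theorem lintegral_rpow_le_of_opNorm_lt {p : ℝ} (hp : 1 < p) {w : (Fin n → ℝ) → ℝ}
    (hw : AEMeasurable w volume) {K : ℝ} (hK : 0 ≤ K) (h : opNorm T p w < ENNReal.ofReal K) (f : D)
    (hf : ∫⁻ x, ‖(f : (Fin n → ℝ) →ₘ[volume] 𝕜) x‖ₑ ^ p * ENNReal.ofReal (w x) ≠ ∞) :
    ∫⁻ x, ‖T f x‖ₑ ^ p * ENNReal.ofReal (w x) ≤ ENNReal.ofReal (K ^ p) *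
      ∫⁻ x, ‖(f : (Fin n → ℝ) →ₘ[volume] 𝕜) x‖ₑ ^ p * ENNReal.ofReal (w x) := by
  have hp0 : 0 < p := by linarith
  obtain ⟨K', hK', hlt⟩ := sInf_lt_iff.1 h
  have h1 := (hK' f (memLp_wMeasure hp hw hf)).trans (mul_le_mul_left hlt.le _)
  have h2 := ENNReal.rpow_le_rpow h1 hp0.le
  rwa [ENNReal.mul_rpow_of_nonneg _ _ hp0.le, eLpNorm_wMeasure_rpow hp hw,
    eLpNorm_wMeasure_rpow hp hw, ENNReal.ofReal_rpow_of_nonneg hK hp0.le] at h2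

theorem opNorm_le_of_lintegral_rpow_le {p : ℝ} (hp : 1 < p) {w : (Fin n → ℝ) → ℝ}
    (hw : AEMeasurable w volume) {K : ℝ} (hK : 0 ≤ K)
    (h : ∀ f : D, ∫⁻ x, ‖(f : (Fin n → ℝ) →ₘ[volume] 𝕜) x‖ₑ ^ p * ENNReal.ofReal (w x) ≠ ∞ →
      ∫⁻ x, ‖T f x‖ₑ ^ p * ENNReal.ofReal (w x) ≤ ENNReal.ofReal (K ^ p) *
      ∫⁻ x, ‖(f : (Fin n → ℝ) →ₘ[volume] 𝕜) x‖ₑ ^ p * ENNReal.ofReal (w x)) :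
    opNorm T p w ≤ ENNReal.ofReal K := by
  have hp0 : 0 < p := by linarith
  refine sInf_le fun f hf => ?_
  have hft : ∫⁻ x, ‖(f : (Fin n → ℝ) →ₘ[volume] 𝕜) x‖ₑ ^ p * ENNReal.ofReal (w x) ≠ ∞ := by
    rw [← eLpNorm_wMeasure_rpow hp hw]
    exact ENNReal.rpow_ne_top_of_nonneg hp0.le hf.2.ne
  have h1 := h f hft
  rw [← eLpNorm_wMeasure_rpow hp hw, ← eLpNorm_wMeasure_rpow hp hw,
    ← ENNReal.ofReal_rpow_of_nonneg hK hp0.le, ← ENNReal.mul_rpow_of_nonneg _ _ hp0.le] at h1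
  exact (ENNReal.rpow_le_rpow_iff hp0).1 h1

theorem splitCost_mul_enorm_add_le {p : ℝ} (hp : 1 < p) (s : ℝ) {x y z : 𝕜}
    (h : ‖z‖ ≤ ‖x‖ + ‖y‖) :
    ‖z‖ₑ ^ p * ENNReal.ofReal (splitCost p s) ≤
      ‖x‖ₑ ^ p + ENNReal.ofReal (Real.exp s) * ‖y‖ₑ ^ p := by
  have hp0 : 0 ≤ p := by linarith
  rw [← ofReal_norm, ← ofReal_norm, ← ofReal_norm,
    ENNReal.ofReal_rpow_of_nonneg (norm_nonneg _) hp0,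
    ENNReal.ofReal_rpow_of_nonneg (norm_nonneg _) hp0,
    ENNReal.ofReal_rpow_of_nonneg (norm_nonneg _) hp0, ← ENNReal.ofReal_mul (by positivity),
    ← ENNReal.ofReal_mul (by positivity), ← ENNReal.ofReal_add (by positivity) (by positivity)]
  refine ENNReal.ofReal_le_ofReal ?_
  refine le_trans ?_ (splitCost_mul_add_rpow_le hp s (norm_nonneg x) (norm_nonneg y))
  rw [mul_comm]
  have := splitCost_pos p s
  gcongr

/-- The `K`-functional estimate for a sublinear operator that is bounded on two weighted
spaces. -/
theorem lintegral_splitCost_le {p : ℝ} (hp : 1 < p) (hT : IsSublinear T)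
    {w₀ w₁ ρ : (Fin n → ℝ) → ℝ} (hw₀ : IsWeight w₀) (hρ : AEMeasurable ρ volume)
    (hw₁ : ∀ᵐ x, w₁ x = w₀ x * Real.exp (ρ x)) (hw₁m : AEMeasurable w₁ volume)
    (hD₀ : ∀ f : (Fin n → ℝ) →ₘ[volume] 𝕜,
      MemLp f (ENNReal.ofReal p) (wMeasure w₀) → f ∈ D)
    {K₀ K₁ : ℝ} (hK₀ : 0 < K₀) (hK₁ : 0 < K₁) (h₀ : opNorm T p w₀ < ENNReal.ofReal K₀)
    (h₁ : opNorm T p w₁ < ENNReal.ofReal K₁) {θ : ℝ} (hθ0 : 0 ≤ θ) (hθ1 : θ ≤ 1) (f : D)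
    (hf : ∫⁻ x, ‖(f : (Fin n → ℝ) →ₘ[volume] 𝕜) x‖ₑ ^ p * ENNReal.ofReal (w₀ x) *
      ENNReal.ofReal (Real.exp (θ * ρ x)) ≠ ∞) (s : ℝ) :
    ∫⁻ x, ‖T f x‖ₑ ^ p * ENNReal.ofReal (w₀ x) * ENNReal.ofReal (splitCost p (s + ρ x)) ≤
      ENNReal.ofReal (K₀ ^ p) *
        ∫⁻ x, ‖(f : (Fin n → ℝ) →ₘ[volume] 𝕜) x‖ₑ ^ p * ENNReal.ofReal (w₀ x) *
          ENNReal.ofReal (splitCost p (s + (p * Real.log (K₁ / K₀) + ρ x))) := by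
  have hp0 : 0 < p := by linarith
  -- The shift that absorbs the ratio of the two operator bounds: `K₀^p J₀ + e^s K₁^p J₁ = K₀^p (J₀
  -- + e^(s+κ) J₁)`. The function `f` is therefore split optimally at `s + κ + ρ`, while `T f` is
  -- measured at `s + ρ`.
  set κ := p * Real.log (K₁ / K₀) with hκ
  have hκexp : K₁ ^ p = K₀ ^ p * Real.exp κ := by
    rw [hκ, mul_comm p, Real.exp_mul, Real.exp_log (by positivity),
      Real.div_rpow hK₁.le hK₀.le]
    field_simp
  set α : (Fin n → ℝ) → ℝ := fun x => splitCoeff p (s + (κ + ρ x)) with hα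
  have hαm : AEMeasurable α volume :=
    (continuous_splitCoeff p).measurable.comp_aemeasurable ((hρ.const_add κ).const_add s)
  have hα0 : ∀ x, 0 < α x := fun x => splitCoeff_pos p _
  have hα1 : ∀ x, 0 < 1 - α x := fun x => sub_pos.2 (splitCoeff_lt_one p _)
  have hw₀m := hw₀.aemeasurable
  set φ : (Fin n → ℝ) → ℝ≥0∞ := fun x =>
    ‖(f : (Fin n → ℝ) →ₘ[volume] 𝕜) x‖ₑ ^ p * ENNReal.ofReal (w₀ x) with hφ
  set I := ∫⁻ x, φ x * ENNReal.ofReal (splitCost p (s + (κ + ρ x))) with hI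
  -- Finiteness puts both parts of the splitting in the spaces where the operator bounds apply.
  have hIfin : I ≠ ∞ := by
    have : I ≤ ENNReal.ofReal (Real.exp (θ * (s + κ))) *
        ∫⁻ x, φ x * ENNReal.ofReal (Real.exp (θ * ρ x)) := by
      rw [← lintegral_const_mul' _ _ ENNReal.ofReal_ne_top]
      refine lintegral_mono fun x => ?_
      rw [mul_left_comm, ← ENNReal.ofReal_mul (Real.exp_pos _).le, ← Real.exp_add]
      gcongr
      refine (splitCost_le_exp_mul hp hθ0 hθ1 _).trans_eq ?_
      congr 1
      ring
    exact ne_top_of_le_ne_top (ENNReal.mul_ne_top ENNReal.ofReal_ne_top hf) this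
  -- the two parts of the optimal splitting
  have hf₀m : AEStronglyMeasurable
      (fun x => ((α x : ℝ) : 𝕜) * (f : (Fin n → ℝ) →ₘ[volume] 𝕜) x) volume :=
    (RCLike.continuous_ofReal.measurable.comp_aemeasurable hαm).aestronglyMeasurable.mul
      (f : (Fin n → ℝ) →ₘ[volume] 𝕜).aestronglyMeasurable
  set f₀ : (Fin n → ℝ) →ₘ[volume] 𝕜 := AEEqFun.mk _ hf₀m with hf₀def
  have hf₀ : ∀ᵐ x, ‖f₀ x‖ₑ ^ p = ENNReal.ofReal (α x ^ p) *
      ‖(f : (Fin n → ℝ) →ₘ[volume] 𝕜) x‖ₑ ^ p := by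
    filter_upwards [AEEqFun.coeFn_mk _ hf₀m] with x hx
    rw [hf₀def, hx, enorm_mul, ENNReal.mul_rpow_of_nonneg _ _ hp0.le, ← ofReal_norm,
      RCLike.norm_of_nonneg (hα0 x).le, ENNReal.ofReal_rpow_of_nonneg (hα0 x).le hp0.le]
  have hf₁ : ∀ᵐ x, ‖((f : (Fin n → ℝ) →ₘ[volume] 𝕜) - f₀) x‖ₑ ^ p =
      ENNReal.ofReal ((1 - α x) ^ p) * ‖(f : (Fin n → ℝ) →ₘ[volume] 𝕜) x‖ₑ ^ p := by
    filter_upwards [AEEqFun.coeFn_mk _ hf₀m,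
      AEEqFun.coeFn_sub (f : (Fin n → ℝ) →ₘ[volume] 𝕜) f₀] with x hx hx'
    have e : (f : (Fin n → ℝ) →ₘ[volume] 𝕜) x - ((α x : ℝ) : 𝕜) *
        (f : (Fin n → ℝ) →ₘ[volume] 𝕜) x =
        ((1 - α x : ℝ) : 𝕜) * (f : (Fin n → ℝ) →ₘ[volume] 𝕜) x := by
      push_cast; ring
    rw [hx', Pi.sub_apply, hf₀def, hx, e, enorm_mul, ENNReal.mul_rpow_of_nonneg _ _ hp0.le,
      ← ofReal_norm, RCLike.norm_of_nonneg (hα1 x).le,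
      ENNReal.ofReal_rpow_of_nonneg (hα1 x).le hp0.le]
  set J₀ := ∫⁻ x, ‖f₀ x‖ₑ ^ p * ENNReal.ofReal (w₀ x) with hJ₀
  set J₁ := ∫⁻ x, ‖((f : (Fin n → ℝ) →ₘ[volume] 𝕜) - f₀) x‖ₑ ^ p * ENNReal.ofReal (w₁ x) with hJ₁
  have hsum : J₀ + ENNReal.ofReal (Real.exp (s + κ)) * J₁ = I := by
    rw [hJ₀, hJ₁, ← lintegral_const_mul' _ _ ENNReal.ofReal_ne_top, ← lintegral_add_left'
      (aemeasurable_enorm_rpow_mul p hw₀m f₀)]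
    refine lintegral_congr_ae ?_
    filter_upwards [hf₀, hf₁, hw₁] with x hx₀ hx₁ hxw
    have h2 : 0 ≤ (1 - α x) ^ p := Real.rpow_nonneg (hα1 x).le _
    have h3 : 0 ≤ α x ^ p := Real.rpow_nonneg (hα0 x).le _
    rw [hx₀, hx₁, hxw, ← splitCoeff_rpow_add hp, ENNReal.ofReal_mul' (Real.exp_pos _).le,
      ENNReal.ofReal_add h3 (by positivity), ENNReal.ofReal_mul (Real.exp_pos _).le,
      ← add_assoc s κ, Real.exp_add (s + κ), ENNReal.ofReal_mul (Real.exp_pos _).le, hφ, hα]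
    simp only [← add_assoc s κ]
    ring
  have hJ₀fin : J₀ ≠ ∞ := ne_top_of_le_ne_top hIfin (hsum ▸ le_self_add)
  have hJ₁fin : J₁ ≠ ∞ := by
    intro htop
    rw [htop, ENNReal.mul_top (by simpa using Real.exp_pos (s + κ))] at hsum
    exact hIfin (by rw [← hsum, add_top])
  have hf₀D : f₀ ∈ D := hD₀ _ (memLp_wMeasure hp hw₀m hJ₀fin)
  -- Only the domain condition at `w₀` is needed, since `D` is a subspace.
  have hf₁D : (f : (Fin n → ℝ) →ₘ[volume] 𝕜) - f₀ ∈ D := D.sub_mem f.2 hf₀D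
  have hB₀ := lintegral_rpow_le_of_opNorm_lt hp hw₀m hK₀.le h₀ ⟨f₀, hf₀D⟩ hJ₀fin
  have hB₁ := lintegral_rpow_le_of_opNorm_lt hp hw₁m hK₁.le h₁ ⟨_, hf₁D⟩ hJ₁fin
  set g₀ := T ⟨f₀, hf₀D⟩
  set g₁ := T ⟨_, hf₁D⟩
  have hadd : ∀ᵐ x, ‖T f x‖ ≤ ‖g₀ x‖ + ‖g₁ x‖ := by
    have h := hT.1 ⟨f₀, hf₀D⟩ ⟨_, hf₁D⟩
    have e : (⟨f₀, hf₀D⟩ : D) + ⟨_, hf₁D⟩ = f := Subtype.ext (by simp)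
    rwa [e] at h
  calc _ ≤ ∫⁻ x, (‖g₀ x‖ₑ ^ p * ENNReal.ofReal (w₀ x) +
          ENNReal.ofReal (Real.exp s) * (‖g₁ x‖ₑ ^ p * ENNReal.ofReal (w₁ x))) := by
        refine lintegral_mono_ae ?_
        filter_upwards [hadd, hw₁] with x hx hxw
        have h := mul_le_mul_left (splitCost_mul_enorm_add_le hp (s + ρ x) hx)
          (ENNReal.ofReal (w₀ x))
        rw [mul_right_comm]
        refine h.trans_eq ?_
        rw [hxw, ENNReal.ofReal_mul' (Real.exp_pos _).le, Real.exp_add,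
          ENNReal.ofReal_mul (Real.exp_pos _).le]
        ring
    _ = (∫⁻ x, ‖g₀ x‖ₑ ^ p * ENNReal.ofReal (w₀ x)) + ENNReal.ofReal (Real.exp s) *
          ∫⁻ x, ‖g₁ x‖ₑ ^ p * ENNReal.ofReal (w₁ x) := by
        rw [lintegral_add_left'
          (aemeasurable_enorm_rpow_mul p hw₀m g₀),
          lintegral_const_mul' _ _ ENNReal.ofReal_ne_top]
    _ ≤ ENNReal.ofReal (K₀ ^ p) * J₀ + ENNReal.ofReal (Real.exp s) *
          (ENNReal.ofReal (K₁ ^ p) * J₁) := by gcongr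
    _ = ENNReal.ofReal (K₀ ^ p) * I := by
        rw [← hsum, hκexp, ENNReal.ofReal_mul (by positivity), Real.exp_add,
          ENNReal.ofReal_mul (Real.exp_pos _).le]
        ring

/-- Interpolation with change of measure for sublinear operators. -/
theorem opNorm_le_interpolation {p : ℝ} (hp : 1 < p) (hT : IsSublinear T)
    {w₀ w₁ w ρ : (Fin n → ℝ) → ℝ} (hw₀ : IsWeight w₀) (hρ : AEMeasurable ρ volume)
    (hw₁m : AEMeasurable w₁ volume) (hwm : AEMeasurable w volume)
    (hw₁ : ∀ᵐ x, w₁ x = w₀ x * Real.exp (ρ x)) {θ : ℝ} (hθ0 : 0 < θ) (hθ1 : θ < 1)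
    (hw : ∀ᵐ x, w x = w₀ x * Real.exp (θ * ρ x))
    (hD₀ : ∀ f : (Fin n → ℝ) →ₘ[volume] 𝕜,
      MemLp f (ENNReal.ofReal p) (wMeasure w₀) → f ∈ D)
    {K₀ K₁ : ℝ} (hK₀ : 0 < K₀) (hK₁ : 0 < K₁) (h₀ : opNorm T p w₀ < ENNReal.ofReal K₀)
    (h₁ : opNorm T p w₁ < ENNReal.ofReal K₁) :
    opNorm T p w ≤ ENNReal.ofReal (K₀ ^ (1 - θ) * K₁ ^ θ) := by
  have e : ∀ f : (Fin n → ℝ) →ₘ[volume] 𝕜, ∫⁻ x, ‖f x‖ₑ ^ p * ENNReal.ofReal (w x) =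
      ∫⁻ x, ‖f x‖ₑ ^ p * ENNReal.ofReal (w₀ x) * ENNReal.ofReal (Real.exp (θ * ρ x)) := by
    intro f
    refine lintegral_congr_ae ?_
    filter_upwards [hw] with x hx
    rw [hx, ENNReal.ofReal_mul' (Real.exp_pos _).le, mul_assoc]
  have hm := aemeasurable_enorm_rpow_mul (𝕜 := 𝕜) p hw₀.aemeasurable
  refine opNorm_le_of_lintegral_rpow_le hp hwm (by positivity) fun f hf => ?_
  rw [e] at hf
  rw [e, e]
  have h := lintegral_mul_exp_le_of_splitCost hp hθ0 hθ1
    (hm f) (hm (T f)) hρ (Real.rpow_nonneg hK₀.le p)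
    (lintegral_splitCost_le hp hT hw₀ hρ hw₁ hw₁m hD₀ hK₀ hK₁ h₀ h₁ hθ0.le hθ1.le f hf)
  have hconst : K₀ ^ p * Real.exp (θ * (p * Real.log (K₁ / K₀))) =
      (K₀ ^ (1 - θ) * K₁ ^ θ) ^ p := by
    rw [Real.mul_rpow (by positivity) (by positivity), Real.rpow_def_of_pos hK₀,
      Real.rpow_def_of_pos hK₀, Real.rpow_def_of_pos hK₁, ← Real.exp_mul, ← Real.exp_mul,
      ← Real.exp_add, ← Real.exp_add, Real.log_div hK₁.ne' hK₀.ne']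
    congr 1
    ring
  rwa [hconst] at h

/-! ### Comparison of the norms on nearby weights -/

theorem _root_.IsLinearMap.isSublinear {D : Submodule 𝕜 ((Fin n → ℝ) →ₘ[volume] 𝕜)}
    {T : D → ((Fin n → ℝ) →ₘ[volume] 𝕜)} (hT : IsLinearMap 𝕜 T) : IsSublinear T := by
  refine ⟨fun f g => ?_, fun k f => ?_⟩
  · rw [hT.map_add]
    filter_upwards [AEEqFun.coeFn_add (T f) (T g)] with x hx
    rw [hx]
    exact norm_add_le _ _
  · rw [hT.map_smul]
    filter_upwards [AEEqFun.coeFn_smul k (T f)] with x hx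
    rw [hx, Pi.smul_apply, norm_smul]

theorem WeightedBound.opNorm_ne_top {D : Submodule 𝕜 ((Fin n → ℝ) →ₘ[volume] 𝕜)}
    {T : D → ((Fin n → ℝ) →ₘ[volume] 𝕜)} {p c : ℝ} {F : ℝ → ℝ} (hT : WeightedBound T p c F)
    {w : (Fin n → ℝ) → ℝ} (hw : IsAp p w) : opNorm T p w ≠ ∞ :=
  ne_top_of_le_ne_top ENNReal.ofReal_ne_top (hT w hw).2

/-- The interpolation estimate takes positive bounds strictly above the norms; letting `K` decrease
to the norm removes this restriction, including when the norm is `0`. -/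
theorem le_ofReal_rpow_mul_rpow_of_forall_gt {N₀ N : ℝ≥0∞} (hN₀ : N₀ ≠ ∞) {M θ : ℝ} (hθ : θ ≤ 1)
    (h : ∀ K : ℝ, 0 < K → N₀ < ENNReal.ofReal K → N ≤ ENNReal.ofReal (K ^ (1 - θ) * M ^ θ)) :
    N ≤ ENNReal.ofReal (N₀.toReal ^ (1 - θ) * M ^ θ) := by
  have hc : Continuous fun K : ℝ => ENNReal.ofReal (K ^ (1 - θ) * M ^ θ) :=
    ENNReal.continuous_ofReal.comp
      ((Real.continuous_rpow_const (sub_nonneg.2 hθ)).mul continuous_const)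
  refine ge_of_tendsto ((hc.tendsto N₀.toReal).mono_left (nhdsWithin_le_nhds (s := Set.Ioi N₀.toReal))) ?_
  filter_upwards [self_mem_nhdsWithin] with K hK
  have hK0 : 0 < K := lt_of_le_of_lt ENNReal.toReal_nonneg hK
  exact h K hK0 ((ENNReal.lt_ofReal_iff_toReal_lt hN₀).2 hK)

/-- Only `w₀` has its characteristic bounded by `A`: in both inequalities the far endpoint is
written as a perturbation of `w₀`, so `M` does not depend on `w`. -/
theorem exists_opNorm_le_of_dStar_le (n : ℕ) {p : ℝ} (hp : 1 < p) {c : ℝ} (hc : 0 < c) {F : ℝ → ℝ}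
    (hF : MonotoneOn F (Set.Ici 1)) (A : ℝ) :
    ∃ ε : ℝ, 0 < ε ∧ ∃ M : ℝ, 0 < M ∧
      ∀ (D : Submodule 𝕜 ((Fin n → ℝ) →ₘ[volume] 𝕜)) (T : D → ((Fin n → ℝ) →ₘ[volume] 𝕜)),
        IsSublinear T → WeightedBound T p c F →
        ∀ w₀ : (Fin n → ℝ) → ℝ, IsAp p w₀ → apChar p w₀ ≤ ENNReal.ofReal A →
        ∀ θ : ℝ, 0 < θ → θ < 1 →
        ∀ w : (Fin n → ℝ) → ℝ, IsAp p w → dStar w w₀ ≤ ENNReal.ofReal (θ * ε) →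
          opNorm T p w ≤ ENNReal.ofReal ((opNorm T p w₀).toReal ^ (1 - θ) * M ^ θ) ∧
          opNorm T p w₀ ≤ ENNReal.ofReal ((opNorm T p w).toReal ^ (1 - θ) * M ^ θ) := by
  obtain ⟨ε, hε, B, hB⟩ := exists_isAp_mul_exp n hp A
  -- The inner maximum keeps the argument of `F` in `[1, ∞)`; the outer one and the `+ 1` make the
  -- bound positive and strict, as interpolation requires.
  have hMpos : 0 < max (c * F (max 1 B)) 0 + 1 := by positivity
  refine ⟨ε, hε, max (c * F (max 1 B)) 0 + 1, hMpos, ?_⟩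
  intro D T hT hb w₀ hw₀ hA θ hθ0 hθ1 w hw hd
  set M := max (c * F (max 1 B)) 0 + 1 with hM
  have hM1 : c * F (max 1 B) < M := by
    have := le_max_left (c * F (max 1 B)) 0
    linarith
  set u : (Fin n → ℝ) → ℝ := fun x => Real.log (w x) - Real.log (w₀ x) with hu
  have hul : LocallyIntegrable u volume :=
    (hw.locallyIntegrable_log hp).sub (hw₀.locallyIntegrable_log hp)
  have hum : AEMeasurable u volume := hul.aestronglyMeasurable.aemeasurable
  have hwu : ∀ᵐ x, w x = w₀ x * Real.exp (u x) := by
    filter_upwards [hw.1.2, hw₀.1.2] with x hx hx₀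
    rw [hu, Real.exp_sub, Real.exp_log hx, Real.exp_log hx₀]
    field_simp
  -- the weights on the line through `w₀` and `w`
  have hfar : ∀ k : ℝ, |k| ≤ 1 / θ → IsAp p (fun x => w₀ x * Real.exp (k * u x)) ∧
      opNorm T p (fun x => w₀ x * Real.exp (k * u x)) < ENNReal.ofReal M := by
    intro k hk
    have hkb : bmoNorm (fun x => k * u x) ≤ ENNReal.ofReal ε := by
      refine (bmoNorm_const_mul_le k u).trans ((mul_le_mul_right hd _).trans ?_)
      rw [← ENNReal.ofReal_mul (abs_nonneg k)]
      refine ENNReal.ofReal_le_ofReal ?_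
      calc |k| * (θ * ε) ≤ 1 / θ * (θ * ε) := by gcongr
        _ = ε := by field_simp
    obtain ⟨hap, hch⟩ := hB w₀ hw₀ hA (fun x => k * u x) (hul.smul k) hkb
    refine ⟨hap, ((hb _ hap).2.trans (ENNReal.ofReal_le_ofReal ?_)).trans_lt
      ((ENNReal.ofReal_lt_ofReal_iff hMpos).2 hM1)⟩
    have h1 := one_le_apChar hp hap
    refine mul_le_mul_of_nonneg_left (hF ?_ (le_max_left (1 : ℝ) B) ?_) hc.le
    · rw [Set.mem_Ici, ← ENNReal.toReal_one]
      exact ENNReal.toReal_mono hap.2.ne h1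
    · exact ENNReal.toReal_le_of_le_ofReal (by positivity)
        (hch.trans (ENNReal.ofReal_le_ofReal (le_max_right _ _)))
  have hθ' : 1 ≤ 1 / θ := (one_le_div hθ0).2 hθ1.le
  constructor
  · refine le_ofReal_rpow_mul_rpow_of_forall_gt (hb.opNorm_ne_top hw₀) hθ1.le fun K hK hKN => ?_
    obtain ⟨hap, hlt⟩ := hfar (1 / θ) (by rw [abs_of_nonneg (by positivity)])
    refine opNorm_le_interpolation hp hT hw₀.1 (hum.const_mul (1 / θ)) hap.1.aemeasurable
      hw.1.aemeasurable (Eventually.of_forall fun x => rfl) hθ0 hθ1 ?_ (hb w₀ hw₀).1 hK hMpos hKN hlt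
    filter_upwards [hwu] with x hx
    rw [hx]
    congr 2
    field_simp
  · refine le_ofReal_rpow_mul_rpow_of_forall_gt (hb.opNorm_ne_top hw) hθ1.le fun K hK hKN => ?_
    -- The point beyond `w₀` as seen from `w`: `w exp (-u / θ) = w₀ exp ((1 - 1/θ) u)`, whose
    -- coefficient has absolute value `1/θ - 1 ≤ 1/θ`.
    obtain ⟨hap, hlt⟩ := hfar (1 - 1 / θ) (by
      rw [abs_of_nonpos (by linarith)]
      linarith)
    refine opNorm_le_interpolation hp hT hw.1 (hum.const_mul (-(1 / θ))) hap.1.aemeasurable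
      hw₀.1.aemeasurable ?_ hθ0 hθ1 ?_ (hb w hw).1 hK hMpos hKN hlt
    · filter_upwards [hwu] with x hx
      rw [hx, mul_assoc, ← Real.exp_add]
      congr 2
      ring
    · filter_upwards [hwu] with x hx
      rw [hx, mul_assoc, ← Real.exp_add]
      have : u x + θ * (-(1 / θ) * u x) = 0 := by field_simp; ring
      rw [this, Real.exp_zero, mul_one]

theorem ofReal_rpow_mul_rpow_le {N : ℝ≥0∞} (hN : N ≠ ∞) {M θ : ℝ} (hM : 0 ≤ M) (hθ0 : 0 ≤ θ)
    (hθ1 : θ ≤ 1) :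
    ENNReal.ofReal (N.toReal ^ (1 - θ) * M ^ θ) ≤ N + ENNReal.ofReal (θ * M) := by
  have hg : (0 : ℝ) ≤ N.toReal := ENNReal.toReal_nonneg
  have h := Real.geom_mean_le_arith_mean2_weighted (sub_nonneg.2 hθ1) hθ0 hg hM (by ring)
  calc _ ≤ ENNReal.ofReal (N.toReal + θ * M) :=
        ENNReal.ofReal_le_ofReal (h.trans (by nlinarith))
    _ = _ := by rw [ENNReal.ofReal_add hg (by positivity), ENNReal.ofReal_toReal hN]

end WeightedContinuity

end

/-! ### Continuity of the operator norm and the quantitative upper bound -/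

open WeightedContinuity in
theorem theorem3p1 {𝕜 : Type*} [RCLike 𝕜] (n : ℕ) (hn : 0 < n) (p : ℝ) (hp : 1 < p)
    (c : ℝ) (hc : 0 < c) (F : ℝ → ℝ) (hF : MonotoneOn F (Set.Ici 1)) :
    -- continuity of the norm, for linear operators
    (∀ (D : Submodule 𝕜 ((Fin n → ℝ) →ₘ[volume] 𝕜)) (T : D → ((Fin n → ℝ) →ₘ[volume] 𝕜)),
      IsLinearMap 𝕜 T → WeightedBound T p c F →
      ∀ w₀ : (Fin n → ℝ) → ℝ, IsAp p w₀ →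
        Tendsto (fun w : {w : (Fin n → ℝ) → ℝ // IsAp p w} => opNorm T p w.1)
          (comap (fun w : {w : (Fin n → ℝ) → ℝ // IsAp p w} => dStar w.1 w₀) (𝓝 0))
          (𝓝 (opNorm T p w₀))) ∧
    -- the quantitative upper bound, for sublinear operators
    (∀ A : ℝ, ∃ δ₀ : ℝ, 0 < δ₀ ∧ ∀ γ : ℝ≥0∞, ∃ C : ℝ, 0 < C ∧
      ∀ (D : Submodule 𝕜 ((Fin n → ℝ) →ₘ[volume] 𝕜)) (T : D → ((Fin n → ℝ) →ₘ[volume] 𝕜)),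
        IsSublinear T → WeightedBound T p c F →
        ∀ w₀ : (Fin n → ℝ) → ℝ, IsAp p w₀ → (apChar p w₀).toReal = A → opNorm T p w₀ = γ →
          ∀ δ : ℝ, 0 < δ → δ ≤ δ₀ →
            ∀ w : (Fin n → ℝ) → ℝ, IsAp p w → dStar w w₀ ≤ ENNReal.ofReal δ →
              opNorm T p w ≤ opNorm T p w₀ * ENNReal.ofReal (1 + C * δ)) := by
  constructor
  · intro D T hlin hb w₀ hw₀
    obtain ⟨ε, hε, M, hM, h⟩ := exists_opNorm_le_of_dStar_le (𝕜 := 𝕜) n hp hc hF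
      (apChar p w₀).toReal
    have hA : apChar p w₀ ≤ ENNReal.ofReal (apChar p w₀).toReal :=
      (ENNReal.ofReal_toReal hw₀.2.ne).ge
    rw [ENNReal.tendsto_nhds (hb.opNorm_ne_top hw₀)]
    intro η hη
    obtain ⟨θ, ⟨hθ1, hθM⟩, hθ0⟩ : ∃ θ : ℝ, (θ < 1 ∧ ENNReal.ofReal (θ * M) < η) ∧ 0 < θ := by
      have hlim : Tendsto (fun θ : ℝ => ENNReal.ofReal (θ * M)) (𝓝[>] 0) (𝓝 0) := by
        have : Continuous fun θ : ℝ => ENNReal.ofReal (θ * M) :=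
          ENNReal.continuous_ofReal.comp (continuous_mul_const M)
        simpa using (this.tendsto 0).mono_left nhdsWithin_le_nhds
      have h1 : ∀ᶠ θ : ℝ in 𝓝[>] 0, θ < 1 := nhdsWithin_le_nhds (gt_mem_nhds one_pos)
      exact ((h1.and (hlim.eventually (gt_mem_nhds hη))).and self_mem_nhdsWithin).exists
    have hev : ∀ᶠ t : ℝ≥0∞ in 𝓝 0, t < ENNReal.ofReal (θ * ε) :=
      gt_mem_nhds (by rw [ENNReal.ofReal_pos]; positivity)
    filter_upwards [tendsto_comap.eventually hev] with w hw
    obtain ⟨h1, h2⟩ := h D T hlin.isSublinear hb w₀ hw₀ hA θ hθ0 hθ1 w.1 w.2 hw.le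
    constructor
    · rw [tsub_le_iff_right]
      refine h2.trans ((ofReal_rpow_mul_rpow_le (hb.opNorm_ne_top w.2) hM.le hθ0.le hθ1.le).trans ?_)
      gcongr
    · refine h1.trans ((ofReal_rpow_mul_rpow_le (hb.opNorm_ne_top hw₀) hM.le hθ0.le hθ1.le).trans ?_)
      gcongr
  · intro A
    obtain ⟨ε, hε, M, hM, h⟩ := exists_opNorm_le_of_dStar_le (𝕜 := 𝕜) n hp hc hF A
    -- With `θ = δ / ε`, halving `ε` keeps `θ < 1`. The arithmetic mean bound adds `θM = γ (M /
    -- (εγ)) δ`, which gives `C`; the `+ 1` keeps `C` positive when `γ = 0` and the quotient is `0`.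
    refine ⟨ε / 2, by positivity, fun γ => ⟨M / (ε * γ.toReal) + 1, by positivity, ?_⟩⟩
    intro D T hT hb w₀ hw₀ hA hγ δ hδ hδ₀ w hw hd
    have hθ0 : 0 < δ / ε := by positivity
    have hθ1 : δ / ε < 1 := by rw [div_lt_one hε]; linarith
    have hAle : apChar p w₀ ≤ ENNReal.ofReal A := by
      rw [← hA, ENNReal.ofReal_toReal hw₀.2.ne]
    have hne : γ ≠ ∞ := hγ ▸ hb.opNorm_ne_top hw₀
    have h1 := (h D T hT hb w₀ hw₀ hAle (δ / ε) hθ0 hθ1 w hw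
      (by rwa [div_mul_cancel₀ _ hε.ne'])).1
    rw [hγ] at h1 ⊢
    refine h1.trans ?_
    nth_rewrite 2 [← ENNReal.ofReal_toReal hne]
    rw [← ENNReal.ofReal_mul ENNReal.toReal_nonneg]
    refine ENNReal.ofReal_le_ofReal ?_
    -- If `γ = 0`, the interpolated bound vanishes because `1 - θ > 0`, so the multiplicative
    -- estimate survives.
    rcases (ENNReal.toReal_nonneg (a := γ)).eq_or_lt with h0 | hpos
    · rw [← h0, Real.zero_rpow (by linarith), zero_mul, zero_mul]
    · refine (Real.geom_mean_le_arith_mean2_weighted (sub_nonneg.2 hθ1.le) hθ0.le hpos.le hM.le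
        (by ring)).trans ?_
      have e : γ.toReal * (1 + (M / (ε * γ.toReal) + 1) * δ) =
          γ.toReal + δ / ε * M + γ.toReal * δ := by
        field_simp
        ring
      rw [e]
      have h2 : 0 < γ.toReal * δ := by positivity
      have h3 : 0 < δ / ε * γ.toReal := by positivity
      linarith
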